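/- For a locally integrable function $f$ on $[0,\infty)$ let $Hf(t)=\frac1t\int_0^t f(s)\,ds$ for $t>0$. For $1\le p<\infty$ and $-1<a<p-1$ let $A_{p,a}$ denote the smallest constant $K\ge 0$ such that $$\int_0^\infty |Hf(t)-f(t)|^p\,t^a\,dt\le K^p\int_0^\infty |f(t)|^p\,t^a\,dt$$ for all nonnegative functions $f$ that are nonincreasing on $(0,\infty)$ and for which the right-hand side is finite. For $\alpha<\frac{p-1-a}{p}<\beta$ put $$k_{p,a}(\alpha,\beta)=\frac{\bigl(\beta-\frac{p-1-a}{p}\bigr)|\alpha-1|^p+\bigl(\frac{p-1-a}{p}-\alpha\bigr)|\beta-1|^p}{\bigl(\beta-\frac{p-1-a}{p}\bigr)|\alpha|^p+\bigl(\frac{p-1-a}{p}-\alpha\bigr)|\beta|^p}.$$ Then this smallest constant exists for all $1\le p<\infty$ and $-1<a<p-1$, and $$A_{p,a}^p=\begin{cases} \frac{1+a}{-a} & \text{if } p=1,\\ \bigl(\frac{1+a}{p-1-a}\bigr)^p & \text{if } 1<p\le 2,\ p-1-p^{\frac{p-2}{p-1}}\le a<p-1,\\ k_{p,a}(\alpha_0,1)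 & \text{if } 1<p\le 2,\ p-2<a<p-1-p^{\frac{p-2}{p-1}},\\ \frac{1+a}{p-1-a} & \text{if } 1<p\le 2,\ -1<a\le p-2,\\ \bigl(\frac{1+a}{p-1-a}\bigr)^p & \text{if } p>2,\ p^{\frac{p-2}{p-1}}-1\le a<p-1,\\ k_{p,a}(0,\beta_0) & \text{if } p>2,\ 0<a<p^{\frac{p-2}{p-1}}-1,\\ \frac{1+a}{p-1-a} & \text{if } p>2,\ -1<a\le 0. \end{cases}$$ Here, in the third case (which is empty for $p=2$), $\alpha_0=\alpha_0(p,a)$ is the solution, which exists and is unique, of $$-(p-1)(1-\alpha_0)+1+a-(1+a)\alpha_0^{p-1}=0$$ in the interval $\bigl(0,\frac{p-1-a}{p}\bigr)$; in the sixth case, $\beta_0=\beta_0(p,a)$ is the solution, which exists and is unique, of $$-(p-1-a)(1-\beta_0)^{p-1}-(p-1)\beta_0+p-1-a=0$$ in the interval $\bigl(\frac{p-1-a}{p},1\bigr)$. -/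

import Mathlib

open Set MeasureTheory

noncomputable section

namespace HardyDecreasing

/-- The Hardy operator `H f (t) = (1/t) ∫₀ᵗ f(s) ds`, for `t > 0`. -/
def hardyOp (f : ℝ → ℝ) (t : ℝ) : ℝ :=
  (1 / t) * ∫ s in (0 : ℝ)..t, f s

/-- The weighted integral `∫₀^∞ |g(t)|^p t^a dt`, with value in `[0, ∞]`. -/
def weightedInt (p a : ℝ) (g : ℝ → ℝ) : ENNReal :=
  ∫⁻ t in Ioi (0 : ℝ), ENNReal.ofReal (|g t| ^ p * t ^ a)

/-- The constants `K ≥ 0` for which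
`∫₀^∞ |Hf - f|^p t^a dt ≤ K^p ∫₀^∞ |f|^p t^a dt`
for all nonnegative, nonincreasing `f` on `(0, ∞)` for which the right-hand side is finite.
Only the values of `f` on `(0, ∞)` matter; `f` may be unbounded near `0`. -/
def admissibleConstants (p a : ℝ) : Set ℝ :=
  {K : ℝ | 0 ≤ K ∧ ∀ f : ℝ → ℝ, (∀ t ∈ Ioi (0 : ℝ), 0 ≤ f t) → AntitoneOn f (Ioi (0 : ℝ)) →
    weightedInt p a f < ⊤ →
    weightedInt p a (fun t => hardyOp f t - f t) ≤ ENNReal.ofReal (K ^ p) * weightedInt p a f}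

/-- The best constant `A_{p,a}`. -/
def bestConstant (p a : ℝ) : ℝ :=
  sInf (admissibleConstants p a)

/-- The function `k_{p,a}(α, β)`, for `α < (p-1-a)/p < β`. -/
def kFun (p a α β : ℝ) : ℝ :=
  ((β - (p - 1 - a) / p) * |α - 1| ^ p + ((p - 1 - a) / p - α) * |β - 1| ^ p) /
    ((β - (p - 1 - a) / p) * |α| ^ p + ((p - 1 - a) / p - α) * |β| ^ p)

/-- `α` lies in `(0, (p-1-a)/p)` and solves the equation that defines `α₀(p,a)`. -/
def IsAlphaRoot (p a α : ℝ) : Prop :=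
  α ∈ Ioo (0 : ℝ) ((p - 1 - a) / p) ∧
    -(p - 1) * (1 - α) + 1 + a - (1 + a) * α ^ (p - 1) = 0

/-- `β` lies in `((p-1-a)/p, 1)` and solves the equation that defines `β₀(p,a)`. -/
def IsBetaRoot (p a β : ℝ) : Prop :=
  β ∈ Ioo ((p - 1 - a) / p) (1 : ℝ) ∧
    -(p - 1 - a) * (1 - β) ^ (p - 1) - (p - 1) * β + p - 1 - a = 0

end HardyDecreasing

end

namespace HardyDecreasing

/-! Put c = (p-1-a)/p, which lies in (0,1), and F = Hf. For decreasing f ≥ 0 the ratio z = f/F lies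
in [0,1], and F' = (f-F)/t gives (t^(a+1) F^p)' = p t^a F^p (z - c) almost everywhere. Suppose that
φ_M(z) = (1-z)^p - M z^p lies on [0,1] below some line l(z-c) through (c,0). Multiplying by t^a F^p
and integrating bounds ∫ |F-f|^p t^a by M ∫ f^p t^a: the right-hand side of the line is an exact
derivative, whose boundary term vanishes at 0 and has the good sign at ∞
(`weightedInt_hardyOp_sub_le`).

Conversely, let x < c < y in [0,1] and let f have f/F = y on (0,1] and f/F = x on (1,∞). Then every
admissible K satisfies K^p ≥ k(x,y) (`le_rpow_mul_of_mem_admissibleConstants`). If the line meets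
the graph of φ_M at x and y, averaging the two equalities at c gives M = k(x,y), so the two bounds
agree. When the line is tangent at c itself, let x, y → c.

It remains to find the touching line. For p < 2, φ_M is concave and then convex, so the line is
tangent at c, or tangent at some α₀ < c and passes through the endpoint at 1, or is the chord
between the endpoints at 0 and 1. For p > 2 the shape is reversed and 0 takes the place of 1, with a
tangency at β₀ > c. The thresholds in a mark the passage between these configurations. -/

/-! ### Signs of functions with one change of convexity -/

theorem strictConvexOn_Icc_of_hasDerivAt2_pos {h h' h'' : ℝ → ℝ} {u v : ℝ}
    (hc : ContinuousOn h (Icc u v)) (h1 : ∀ x ∈ Ioo u v, HasDerivAt h (h' x) x)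
    (h2 : ∀ x ∈ Ioo u v, HasDerivAt h' (h'' x) x) (h3 : ∀ x ∈ Ioo u v, 0 < h'' x) :
    StrictConvexOn ℝ (Icc u v) h := by
  refine strictConvexOn_of_deriv2_pos (convex_Icc u v) hc fun x hx => ?_
  rw [interior_Icc] at hx
  have he : deriv h =ᶠ[nhds x] h' :=
    Filter.eventuallyEq_of_mem (isOpen_Ioo.mem_nhds hx) fun y hy => (h1 y hy).deriv
  have : deriv^[2] h x = h'' x := by
    simpa using he.deriv_eq.trans (h2 x hx).deriv
  rw [this]
  exact h3 x hx

theorem concaveOn_Icc_of_hasDerivAt2_nonpos {h h' h'' : ℝ → ℝ} {u v : ℝ}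
    (hc : ContinuousOn h (Icc u v)) (h1 : ∀ x ∈ Ioo u v, HasDerivAt h (h' x) x)
    (h2 : ∀ x ∈ Ioo u v, HasDerivAt h' (h'' x) x) (h3 : ∀ x ∈ Ioo u v, h'' x ≤ 0) :
    ConcaveOn ℝ (Icc u v) h := by
  refine concaveOn_of_hasDerivWithinAt2_nonpos (f' := h') (f'' := h'') (convex_Icc u v) hc ?_ ?_ ?_
  all_goals rw [interior_Icc]
  · exact fun x hx => (h1 x hx).hasDerivWithinAt
  · exact fun x hx => (h2 x hx).hasDerivWithinAt
  · exact h3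

theorem ConcaveOn.nonpos_of_tangent {S : Set ℝ} {h : ℝ → ℝ} {y : ℝ} (hh : ConcaveOn ℝ S h)
    (hy : y ∈ S) (h0 : h y = 0) (hd : HasDerivAt h 0 y) {x : ℝ} (hx : x ∈ S) : h x ≤ 0 := by
  rcases lt_trichotomy x y with hxy | rfl | hxy
  · have := hh.le_slope_of_hasDerivAt hx hy hxy hd
    rw [slope_def_field, h0, zero_sub] at this
    by_contra! hpos
    exact absurd this (not_le.2 (div_neg_of_neg_of_pos (by linarith) (by linarith)))
  · exact h0.le
  · have := hh.slope_le_of_hasDerivAt hy hx hxy hd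
    rw [slope_def_field, h0, sub_zero] at this
    by_contra! hpos
    exact absurd this (not_le.2 (div_pos hpos (by linarith)))

theorem ConvexOn.nonpos_of_endpoints {h : ℝ → ℝ} {u v : ℝ} (hh : ConvexOn ℝ (Icc u v) h)
    (hu : h u ≤ 0) (hv : h v ≤ 0) {x : ℝ} (hx : x ∈ Icc u v) : h x ≤ 0 := by
  have huv : u ≤ v := hx.1.trans hx.2
  have := hh.le_max_of_mem_Icc (left_mem_Icc.2 huv) (right_mem_Icc.2 huv) hx
  exact this.trans (max_le hu hv)

/-- The zero tangent at y dominates h on the concave part, in particular at s. On the convex part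
the values at the two ends s and 1 suffice. -/
theorem nonpos_of_concaveOn_of_strictConvexOn {h : ℝ → ℝ} {s y : ℝ} (hs : s ∈ Ioo (0 : ℝ) 1)
    (hconc : ConcaveOn ℝ (Icc 0 s) h) (hconv : StrictConvexOn ℝ (Icc s 1) h)
    (hy : y ∈ Ioo (0 : ℝ) 1) (h0 : h y = 0) (hd : HasDerivAt h 0 y) (h1 : h 1 ≤ 0)
    {x : ℝ} (hx : x ∈ Icc (0 : ℝ) 1) : h x ≤ 0 := by
  -- A horizontal tangent at height 0 inside the strictly convex part would force h 1 > 0.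
  have hys : y ≤ s := by
    by_contra! hlt
    have := hconv.lt_slope_of_hasDerivAt ⟨hlt.le, hy.2.le⟩ (right_mem_Icc.2 hs.2.le) hy.2 hd
    rw [slope_def_field, h0, sub_zero] at this
    exact absurd this (not_lt.2 (div_nonpos_of_nonpos_of_nonneg h1 (by linarith [hy.2])))
  have hleft : ∀ z ∈ Icc (0 : ℝ) s, h z ≤ 0 := fun z hz =>
    ConcaveOn.nonpos_of_tangent hconc ⟨hy.1.le, hys⟩ h0 hd hz
  rcases le_total x s with hxs | hxs
  · exact hleft x ⟨hx.1, hxs⟩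
  · exact ConvexOn.nonpos_of_endpoints hconv.convexOn (hleft s ⟨hs.1.le, le_rfl⟩) h1 ⟨hxs, hx.2⟩

theorem nonpos_of_strictConvexOn_of_concaveOn {h : ℝ → ℝ} {s y : ℝ} (hs : s ∈ Ioo (0 : ℝ) 1)
    (hconv : StrictConvexOn ℝ (Icc 0 s) h) (hconc : ConcaveOn ℝ (Icc s 1) h)
    (hy : y ∈ Ioo (0 : ℝ) 1) (h0 : h y = 0) (hd : HasDerivAt h 0 y) (h1 : h 0 ≤ 0)
    {x : ℝ} (hx : x ∈ Icc (0 : ℝ) 1) : h x ≤ 0 := by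
  have hys : s ≤ y := by
    by_contra! hlt
    have := hconv.slope_lt_of_hasDerivAt (left_mem_Icc.2 hs.1.le) ⟨hy.1.le, hlt.le⟩ hy.1 hd
    rw [slope_def_field, h0] at this
    exact absurd this (not_lt.2 (div_nonneg (by linarith) (by linarith [hy.1])))
  have hright : ∀ z ∈ Icc s (1 : ℝ), h z ≤ 0 := fun z hz =>
    ConcaveOn.nonpos_of_tangent hconc ⟨hys, hy.2.le⟩ h0 hd hz
  rcases le_total x s with hxs | hxs
  · exact ConvexOn.nonpos_of_endpoints hconv.convexOn h1 (hright s ⟨le_rfl, hs.2.le⟩) ⟨hx.1, hxs⟩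
  · exact hright x ⟨hxs, hx.2⟩

/-! ### The gap between the profile and a line -/

section Gap

variable {p M l c : ℝ}

/-- The gap between `(1 - x)^p - M x^p` and the line of slope `l` that vanishes at `c`. -/
noncomputable def gap (p M l c x : ℝ) : ℝ := (1 - x) ^ p - M * x ^ p - l * (x - c)

theorem continuous_gap (hp : 0 < p) : Continuous (gap p M l c) := by
  unfold gap
  have h1 : Continuous fun x : ℝ => (1 - x) ^ p :=
    (continuous_const.sub continuous_id).rpow_const fun _ => Or.inr hp.le
  have h2 : Continuous fun x : ℝ => x ^ p := continuous_id.rpow_const fun _ => Or.inr hp.le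
  fun_prop

theorem hasDerivAt_gap {x : ℝ} (hx : x ∈ Ioo (0 : ℝ) 1) :
    HasDerivAt (gap p M l c) (-(p * (1 - x) ^ (p - 1)) - M * (p * x ^ (p - 1)) - l) x := by
  have h1 : HasDerivAt (fun y : ℝ => (1 - y) ^ p) (-1 * p * (1 - x) ^ (p - 1)) x :=
    ((hasDerivAt_id x).const_sub 1).rpow_const (Or.inl (by simpa using (sub_pos.2 hx.2).ne'))
  have h2 : HasDerivAt (fun y : ℝ => y ^ p) (p * x ^ (p - 1)) x :=
    Real.hasDerivAt_rpow_const (Or.inl hx.1.ne')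
  have h3 : HasDerivAt (fun y : ℝ => l * (y - c)) (l * 1) x :=
    ((hasDerivAt_id x).sub_const c).const_mul l
  refine ((h1.sub (h2.const_mul M)).sub h3).congr_deriv ?_
  ring

theorem hasDerivAt_deriv_gap {x : ℝ} (hx : x ∈ Ioo (0 : ℝ) 1) :
    HasDerivAt (fun x => -(p * (1 - x) ^ (p - 1)) - M * (p * x ^ (p - 1)) - l)
      (p * (p - 1) * ((1 - x) ^ (p - 2) - M * x ^ (p - 2))) x := by
  have h1 : HasDerivAt (fun y : ℝ => (1 - y) ^ (p - 1)) (-1 * (p - 1) * (1 - x) ^ (p - 1 - 1)) x :=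
    ((hasDerivAt_id x).const_sub 1).rpow_const (Or.inl (by simpa using (sub_pos.2 hx.2).ne'))
  have h2 : HasDerivAt (fun y : ℝ => y ^ (p - 1)) ((p - 1) * x ^ (p - 1 - 1)) x :=
    Real.hasDerivAt_rpow_const (Or.inl hx.1.ne')
  refine (((h1.const_mul p).neg.sub ((h2.const_mul p).const_mul M)).sub_const l).congr_deriv ?_
  rw [show p - 1 - 1 = p - 2 by ring]
  ring

/-- The second derivative of `gap` has the sign of (1-x)^(p-2) - M x^(p-2). Absorbing M into the
power as r = M^(1/(2-p)) turns this into a comparison of x/r with 1-x, which changes once, at s =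
r/(1+r). -/
theorem exists_inflection (hM : 0 < M) (hp : p ≠ 2) : ∃ r s : ℝ, 0 < r ∧ s ∈ Ioo (0 : ℝ) 1 ∧
    (∀ x, x < s → x < r * (1 - x)) ∧ (∀ x, s < x → r * (1 - x) < x) ∧
    ∀ x, 0 < x → M * x ^ (p - 2) = (x / r) ^ (p - 2) := by
  have hr : 0 < M ^ (1 / (2 - p)) := Real.rpow_pos_of_pos hM _
  set r := M ^ (1 / (2 - p)) with hrd
  have h1r : 0 < 1 + r := by linarith
  refine ⟨r, r / (1 + r), hr, ⟨by positivity, (div_lt_one h1r).2 (by linarith)⟩, ?_, ?_, ?_⟩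
  · intro x hx
    rw [lt_div_iff₀ h1r] at hx
    linarith
  · intro x hx
    rw [div_lt_iff₀ h1r] at hx
    linarith
  · intro x hx
    have hp' : 2 - p ≠ 0 := sub_ne_zero.2 hp.symm
    rw [Real.div_rpow hx.le hr.le, hrd, ← Real.rpow_mul hM.le,
      show 1 / (2 - p) * (p - 2) = -1 by field_simp; ring, Real.rpow_neg_one, div_inv_eq_mul,
      mul_comm]

theorem gap_nonpos_of_lt_two (hp1 : 1 < p) (hp2 : p < 2) (hM : 0 < M) {y : ℝ}
    (hy : y ∈ Ioo (0 : ℝ) 1) (h0 : gap p M l c y = 0)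
    (hd : -(p * (1 - y) ^ (p - 1)) - M * (p * y ^ (p - 1)) - l = 0) (h1 : gap p M l c 1 ≤ 0)
    {x : ℝ} (hx : x ∈ Icc (0 : ℝ) 1) : gap p M l c x ≤ 0 := by
  obtain ⟨r, s, hr, hs, hlt, hgt, hMr⟩ := exists_inflection hM hp2.ne
  have hpp : 0 < p * (p - 1) := by nlinarith
  refine nonpos_of_concaveOn_of_strictConvexOn hs
    (concaveOn_Icc_of_hasDerivAt2_nonpos (continuous_gap (by linarith)).continuousOn
      (fun z hz => hasDerivAt_gap ⟨hz.1, hz.2.trans hs.2⟩)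
      (fun z hz => hasDerivAt_deriv_gap ⟨hz.1, hz.2.trans hs.2⟩) fun z hz => ?_)
    (strictConvexOn_Icc_of_hasDerivAt2_pos (continuous_gap (by linarith)).continuousOn
      (fun z hz => hasDerivAt_gap ⟨hs.1.trans hz.1, hz.2⟩)
      (fun z hz => hasDerivAt_deriv_gap ⟨hs.1.trans hz.1, hz.2⟩) fun z hz => ?_)
    hy h0 (hd ▸ hasDerivAt_gap hy) h1 hx
  · rw [hMr z hz.1]
    refine mul_nonpos_of_nonneg_of_nonpos hpp.le (sub_nonpos.2 ?_)
    refine Real.rpow_le_rpow_of_nonpos (div_pos hz.1 hr) ?_ (by linarith)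
    rw [div_le_iff₀ hr]
    linarith [hlt z hz.2]
  · rw [hMr z (hs.1.trans hz.1)]
    refine mul_pos hpp (sub_pos.2 ?_)
    refine Real.rpow_lt_rpow_of_neg (by linarith [hz.2]) ?_ (by linarith)
    rw [lt_div_iff₀ hr]
    linarith [hgt z hz.1]

theorem gap_nonpos_of_two_lt (hp2 : 2 < p) (hM : 0 < M) {y : ℝ}
    (hy : y ∈ Ioo (0 : ℝ) 1) (h0 : gap p M l c y = 0)
    (hd : -(p * (1 - y) ^ (p - 1)) - M * (p * y ^ (p - 1)) - l = 0) (h1 : gap p M l c 0 ≤ 0)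
    {x : ℝ} (hx : x ∈ Icc (0 : ℝ) 1) : gap p M l c x ≤ 0 := by
  obtain ⟨r, s, hr, hs, hlt, hgt, hMr⟩ := exists_inflection hM hp2.ne'
  have hpp : 0 < p * (p - 1) := by nlinarith
  refine nonpos_of_strictConvexOn_of_concaveOn hs
    (strictConvexOn_Icc_of_hasDerivAt2_pos (continuous_gap (by linarith)).continuousOn
      (fun z hz => hasDerivAt_gap ⟨hz.1, hz.2.trans hs.2⟩)
      (fun z hz => hasDerivAt_deriv_gap ⟨hz.1, hz.2.trans hs.2⟩) fun z hz => ?_)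
    (concaveOn_Icc_of_hasDerivAt2_nonpos (continuous_gap (by linarith)).continuousOn
      (fun z hz => hasDerivAt_gap ⟨hs.1.trans hz.1, hz.2⟩)
      (fun z hz => hasDerivAt_deriv_gap ⟨hs.1.trans hz.1, hz.2⟩) fun z hz => ?_)
    hy h0 (hd ▸ hasDerivAt_gap hy) h1 hx
  · rw [hMr z hz.1]
    refine mul_pos hpp (sub_pos.2 ?_)
    refine Real.rpow_lt_rpow (div_pos hz.1 hr).le ?_ (by linarith)
    rw [div_lt_iff₀ hr]
    linarith [hlt z hz.2]
  · rw [hMr z (hs.1.trans hz.1)]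
    refine mul_nonpos_of_nonneg_of_nonpos hpp.le (sub_nonpos.2 ?_)
    refine Real.rpow_le_rpow (by linarith [hz.2]) ?_ (by linarith)
    rw [le_div_iff₀ hr]
    linarith [hgt z hz.1]

end Gap

/-! ### The touching lines and the root equations -/

section Lines

variable {p c : ℝ}

theorem rpow_eq_mul_rpow_sub_one {x : ℝ} (hp : 1 < p) (hx : 0 ≤ x) : x ^ p = x * x ^ (p - 1) := by
  rcases hx.eq_or_lt with rfl | hx
  · rw [Real.zero_rpow (by linarith), zero_mul]
  · rw [Real.rpow_sub_one hx.ne']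
    field_simp

/-- With M = (1-c)/c, the line of slope -1/c through (c,0) is the chord of the profile: it has the
values 1 at 0 and -M at 1. -/
theorem chord_bound_of_le {x : ℝ} (hc : 0 < c)
    (h : (1 - c) * (x - x ^ p) ≤ c * ((1 - x) - (1 - x) ^ p)) :
    (1 - x) ^ p - (1 - c) / c * x ^ p ≤ -1 / c * (x - c) := by
  have : -1 / c * (x - c) - ((1 - x) ^ p - (1 - c) / c * x ^ p)
      = (c * ((1 - x) - (1 - x) ^ p) - (1 - c) * (x - x ^ p)) / c := by
    field_simp
    ring
  have h2 : 0 ≤ (c * ((1 - x) - (1 - x) ^ p) - (1 - c) * (x - x ^ p)) / c :=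
    div_nonneg (by linarith) hc.le
  linarith

/-- Both sides are compared with multiples of x(1-x), by x ≤ x^(p-1) and Bernoulli's inequality for
(1-x)^(p-1). The multiples are ordered because 1-c ≤ c(p-1), which is pc ≥ 1. -/
theorem chord_bound_of_le_two {x : ℝ} (hp1 : 1 < p) (hp2 : p ≤ 2) (hc : 0 < c) (hc1 : c < 1)
    (hpc : 1 ≤ p * c) (hx : x ∈ Icc (0 : ℝ) 1) :
    (1 - x) ^ p - (1 - c) / c * x ^ p ≤ -1 / c * (x - c) := by
  refine chord_bound_of_le hc ?_
  have h1x : 0 ≤ 1 - x := sub_nonneg.2 hx.2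
  rw [rpow_eq_mul_rpow_sub_one hp1 hx.1, rpow_eq_mul_rpow_sub_one hp1 h1x]
  have hb : (1 - x) ^ (p - 1) ≤ 1 - (p - 1) * x := by
    have := rpow_one_add_le_one_add_mul_self (s := -x) (by linarith [hx.2])
      (p := p - 1) (by linarith) (by linarith)
    rw [← sub_eq_add_neg] at this
    linarith
  have hq : x ≤ x ^ (p - 1) := by
    rcases hx.1.eq_or_lt with h0 | h0
    · rw [← h0, Real.zero_rpow (by linarith)]
    · simpa using Real.rpow_le_rpow_of_exponent_ge h0 hx.2 (show p - 1 ≤ 1 by linarith)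
  calc (1 - c) * (x - x * x ^ (p - 1)) ≤ (1 - c) * (x * (1 - x)) := by
        have := mul_le_mul_of_nonneg_left hq hx.1
        exact mul_le_mul_of_nonneg_left (by linarith) (by linarith)
    _ ≤ (c * (p - 1)) * (x * (1 - x)) :=
        mul_le_mul_of_nonneg_right (by linarith) (mul_nonneg hx.1 h1x)
    _ = c * ((1 - x) * (1 - (1 - (p - 1) * x))) := by ring
    _ ≤ c * ((1 - x) * (1 - (1 - x) ^ (p - 1))) := by gcongr
    _ = _ := by ring

theorem chord_bound_of_two_lt {x : ℝ} (hp2 : 2 < p) (hc : 0 < c) (hc1 : c < 1)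
    (hpc : p - 1 ≤ p * c) (hx : x ∈ Icc (0 : ℝ) 1) :
    (1 - x) ^ p - (1 - c) / c * x ^ p ≤ -1 / c * (x - c) := by
  refine chord_bound_of_le hc ?_
  have h1x : 0 ≤ 1 - x := sub_nonneg.2 hx.2
  have hp1 : 1 < p := by linarith
  rw [rpow_eq_mul_rpow_sub_one hp1 hx.1, rpow_eq_mul_rpow_sub_one hp1 h1x]
  have hb : 1 - (p - 1) * (1 - x) ≤ x ^ (p - 1) := by
    have := one_add_mul_self_le_rpow_one_add (s := x - 1) (by linarith [hx.1])
      (p := p - 1) (by linarith)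
    rw [add_sub_cancel] at this
    linarith
  have hq : (1 - x) ^ (p - 1) ≤ 1 - x := by
    rcases h1x.eq_or_lt with h0 | h0
    · rw [← h0, Real.zero_rpow (by linarith)]
    · simpa using Real.rpow_le_rpow_of_exponent_ge h0 (by linarith [hx.1])
        (show 1 ≤ p - 1 by linarith)
  have h1c : 0 ≤ 1 - c := by linarith
  have h0x := hx.1
  calc (1 - c) * (x - x * x ^ (p - 1)) = (1 - c) * (x * (1 - x ^ (p - 1))) := by ring
    _ ≤ (1 - c) * (x * (1 - (1 - (p - 1) * (1 - x)))) := by gcongr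
    _ = ((1 - c) * (p - 1)) * (x * (1 - x)) := by ring
    _ ≤ c * (x * (1 - x)) :=
        mul_le_mul_of_nonneg_right (by linarith) (mul_nonneg hx.1 h1x)
    _ = c * ((1 - x) * (1 - (1 - x))) := by ring
    _ ≤ c * ((1 - x) * (1 - (1 - x) ^ (p - 1))) := by gcongr
    _ = _ := by ring

/-- M = ((1-c)/c)^p is the value that makes the profile vanish at c; the slope is then its
derivative there. -/
theorem tangent_conditions (hp1 : 1 < p) (hc : c ∈ Ioo (0 : ℝ) 1) :
    0 < ((1 - c) / c) ^ p ∧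
    gap p (((1 - c) / c) ^ p) (-(p * (1 - c) ^ (p - 1) / c)) c c = 0 ∧
    -(p * (1 - c) ^ (p - 1)) - ((1 - c) / c) ^ p * (p * c ^ (p - 1))
      - -(p * (1 - c) ^ (p - 1) / c) = 0 := by
  have h1c : 0 < 1 - c := sub_pos.2 hc.2
  have hcp : 0 < c ^ (p - 1) := Real.rpow_pos_of_pos hc.1 _
  have hc0 := hc.1
  refine ⟨Real.rpow_pos_of_pos (div_pos h1c hc.1) _, ?_, ?_⟩
  · rw [gap, Real.div_rpow h1c.le hc.1.le, div_mul_cancel₀ _ (Real.rpow_pos_of_pos hc.1 _).ne']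
    ring
  · rw [Real.div_rpow h1c.le hc.1.le, rpow_eq_mul_rpow_sub_one hp1 h1c.le,
      rpow_eq_mul_rpow_sub_one hp1 hc.1.le]
    field_simp
    ring

theorem tangent_bound_of_le_two {x : ℝ} (hp1 : 1 < p) (hp2 : p ≤ 2) (hc : c ∈ Ioo (0 : ℝ) 1)
    (hpc : p * c ^ (p - 1) ≤ 1) (hx : x ∈ Icc (0 : ℝ) 1) :
    (1 - x) ^ p - ((1 - c) / c) ^ p * x ^ p ≤ -(p * (1 - c) ^ (p - 1) / c) * (x - c) := by
  have h1c : 0 < 1 - c := sub_pos.2 hc.2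
  have hc0 := hc.1
  rcases hp2.eq_or_lt with rfl | hp2
  -- For p = 2 there is no inflection: the gap is the quadratic (2c-1)(x-c)²/c².
  · norm_num at hpc
    have : (1 - x) ^ (2 : ℝ) - ((1 - c) / c) ^ (2 : ℝ) * x ^ (2 : ℝ)
        - -(2 * (1 - c) ^ ((2 : ℝ) - 1) / c) * (x - c) = (2 * c - 1) * (x - c) ^ 2 / c ^ 2 := by
      norm_num
      field_simp
      ring
    have h2 : (2 * c - 1) * (x - c) ^ 2 / c ^ 2 ≤ 0 :=
      div_nonpos_of_nonpos_of_nonneg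
        (mul_nonpos_of_nonpos_of_nonneg (by linarith) (sq_nonneg _)) (sq_nonneg _)
    linarith
  · obtain ⟨hM, h0, hd⟩ := tangent_conditions hp1 hc
    refine sub_nonpos.1 (gap_nonpos_of_lt_two hp1 hp2 hM hc h0 hd ?_ hx)
    have hcp : 0 < c ^ (p - 1) := Real.rpow_pos_of_pos hc.1 _
    rw [gap, Real.div_rpow h1c.le hc.1.le, rpow_eq_mul_rpow_sub_one hp1 h1c.le,
      rpow_eq_mul_rpow_sub_one hp1 hc.1.le, sub_self, Real.zero_rpow (by linarith), Real.one_rpow]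
    -- The gap at 1 has the sign of p c^(p-1) - 1; this is where the threshold for the tangent case
    -- comes from.
    have : 0 - (1 - c) * (1 - c) ^ (p - 1) / (c * c ^ (p - 1)) * 1
        - -(p * (1 - c) ^ (p - 1) / c) * (1 - c)
        = (1 - c) * (1 - c) ^ (p - 1) * (p * c ^ (p - 1) - 1) / (c * c ^ (p - 1)) := by
      field_simp
      ring
    rw [this]
    exact div_nonpos_of_nonpos_of_nonneg
      (mul_nonpos_of_nonneg_of_nonpos (by positivity) (by linarith)) (by positivity)

theorem tangent_bound_of_two_lt {x : ℝ} (hp2 : 2 < p) (hc : c ∈ Ioo (0 : ℝ) 1)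
    (hpc : 1 ≤ p * (1 - c) ^ (p - 1)) (hx : x ∈ Icc (0 : ℝ) 1) :
    (1 - x) ^ p - ((1 - c) / c) ^ p * x ^ p ≤ -(p * (1 - c) ^ (p - 1) / c) * (x - c) := by
  obtain ⟨hM, h0, hd⟩ := tangent_conditions (show 1 < p by linarith) hc
  refine sub_nonpos.1 (gap_nonpos_of_two_lt hp2 hM hc h0 hd ?_ hx)
  have hc0 := hc.1
  rw [gap, sub_zero, Real.zero_rpow (by linarith), Real.one_rpow]
  have : -(p * (1 - c) ^ (p - 1) / c) * (0 - c) = p * (1 - c) ^ (p - 1) := by field_simp; ring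
  rw [this]
  linarith

/-- The equation of `IsAlphaRoot`, in terms of `c = (p - 1 - a) / p`. -/
theorem alpha_tangent_bound {x y M : ℝ} (hp1 : 1 < p) (hp2 : p < 2) (hy : y ∈ Ioo 0 c)
    (hc1 : c < 1) (hroot : -(p - 1) * (1 - y) + p * (1 - c) - p * (1 - c) * y ^ (p - 1) = 0)
    (hM : M = (1 - c) * (1 - y) ^ p / ((1 - c) * y ^ p + (c - y))) (hx : x ∈ Icc (0 : ℝ) 1) :
    (1 - x) ^ p - M * x ^ p ≤ -(M / (1 - c)) * (x - c) := by
  have h1c : 0 < 1 - c := sub_pos.2 hc1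
  have hy0 := hy.1
  have h1y : 0 < 1 - y := by linarith [hy.2]
  have hyp : 0 < y ^ p := Real.rpow_pos_of_pos hy0 _
  have h1yp : 0 < (1 - y) ^ (p - 1) := Real.rpow_pos_of_pos h1y _
  have hD : 0 < (1 - c) * y ^ p + (c - y) := by nlinarith [hy.2]
  have hDM : M * ((1 - c) * y ^ p + (c - y)) = (1 - c) * (1 - y) ^ p := by
    rw [hM, div_mul_cancel₀ _ hD.ne']
  have hMpos : 0 < M := by
    rw [hM]
    exact div_pos (mul_pos h1c (Real.rpow_pos_of_pos h1y _)) hD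
  -- The root equation removes y^p from the denominator of M, so that contact at y becomes the slope
  -- identity `hslope`, and hence tangency at y.
  have hDeq : p * ((1 - c) * y ^ p + (c - y)) = (1 - y) * (p * c - (p - 1) * y) := by
    rw [rpow_eq_mul_rpow_sub_one hp1 hy0.le]
    linear_combination (-y) * hroot
  have hslope : M * (p * c - (p - 1) * y) = p * (1 - c) * (1 - y) ^ (p - 1) := by
    rw [rpow_eq_mul_rpow_sub_one hp1 h1y.le] at hDM
    refine mul_left_cancel₀ h1y.ne' ?_
    linear_combination p * hDM - M * hDeq
  refine sub_nonpos.1 (gap_nonpos_of_lt_two hp1 hp2 hMpos ⟨hy0, by linarith⟩ ?_ ?_ ?_ hx)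
  · rw [gap]
    field_simp
    linear_combination -hDM
  · field_simp
    linear_combination hslope + M * hroot
  · rw [gap, sub_self, Real.zero_rpow (by linarith), Real.one_rpow, neg_mul,
      div_mul_cancel₀ _ h1c.ne']
    linarith

/-- The equation of `IsBetaRoot`, in terms of `c = (p - 1 - a) / p`. -/
theorem beta_tangent_bound {x y M : ℝ} (hp2 : 2 < p) (hy : y ∈ Ioo c 1)
    (hc : 0 < c) (hroot : -(p * c) * (1 - y) ^ (p - 1) - (p - 1) * y + p * c = 0)
    (hM : M = ((y - c) + c * (1 - y) ^ p) / (c * y ^ p)) (hx : x ∈ Icc (0 : ℝ) 1) :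
    (1 - x) ^ p - M * x ^ p ≤ -1 / c * (x - c) := by
  have hp1 : 1 < p := by linarith
  have hy0 : 0 < y := hc.trans hy.1
  have h1y : 0 < 1 - y := sub_pos.2 hy.2
  have hyp : 0 < y ^ p := Real.rpow_pos_of_pos hy0 _
  have h1yp : 0 < (1 - y) ^ p := Real.rpow_pos_of_pos h1y _
  have hDM : M * (c * y ^ p) = (y - c) + c * (1 - y) ^ p := by
    rw [hM, div_mul_cancel₀ _ (by positivity)]
  have hMpos : 0 < M := by
    rw [hM]
    exact div_pos (by nlinarith [hy.1]) (by positivity)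
  refine sub_nonpos.1 (gap_nonpos_of_two_lt hp2 hMpos ⟨hy0, hy.2⟩ ?_ ?_ ?_ hx)
  · rw [gap]
    field_simp
    linear_combination -hDM
  · rw [rpow_eq_mul_rpow_sub_one hp1 hy0.le, rpow_eq_mul_rpow_sub_one hp1 h1y.le] at hDM
    field_simp
    refine mul_left_cancel₀ hy0.ne' ?_
    linear_combination -p * hDM + hroot
  · rw [gap, sub_zero, Real.zero_rpow (by linarith), Real.one_rpow]
    have : -1 / c * (0 - c) = 1 := by field_simp; ring
    rw [this]
    linarith

theorem existsUnique_alpha_root (hp1 : 1 < p) (hp2 : p < 2) (hc : c ∈ Ioo (0 : ℝ) 1)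
    (hpc : p * c < 1) (hpc' : 1 < p * c ^ (p - 1)) :
    ∃ y ∈ Ioo 0 c, -(p - 1) * (1 - y) + p * (1 - c) - p * (1 - c) * y ^ (p - 1) = 0 ∧
      ∀ z ∈ Ioo 0 c, -(p - 1) * (1 - z) + p * (1 - c) - p * (1 - c) * z ^ (p - 1) = 0 → z = y := by
  set q : ℝ → ℝ := fun z => -(p - 1) * (1 - z) + p * (1 - c) - p * (1 - c) * z ^ (p - 1) with hq
  have hk : 0 < p * (1 - c) := mul_pos (by linarith) (sub_pos.2 hc.2)
  have hcont : Continuous q := by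
    have : Continuous fun z : ℝ => z ^ (p - 1) :=
      continuous_id.rpow_const fun _ => Or.inr (by linarith)
    fun_prop
  have hq0 : 0 < q 0 := by
    simp only [hq, Real.zero_rpow (show p - 1 ≠ 0 by linarith)]
    linarith
  have hqc : q c < 0 := by
    have : q c = (1 - c) * (1 - p * c ^ (p - 1)) := by simp only [hq]; ring
    rw [this]
    exact mul_neg_of_pos_of_neg (sub_pos.2 hc.2) (by linarith)
  -- Since z^(p-1) is concave, q is convex; after a zero it stays negative up to c, where q c < 0.
  -- This excludes a second zero.
  have hconv : ∀ u z v : ℝ, 0 ≤ u → u < z → z < v → q u = 0 → q v < 0 → q z < 0 := by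
    intro u z v hu huz hzv hqu hqv
    have hcon := (Real.concaveOn_rpow (p := p - 1) (by linarith) (by linarith))
    have hv : 0 < v - u := by linarith
    have := hcon.2 hu (show (0 : ℝ) ≤ v by linarith)
      (show 0 ≤ (v - z) / (v - u) by apply div_nonneg <;> linarith)
      (show 0 ≤ (z - u) / (v - u) by apply div_nonneg <;> linarith) (by field_simp; ring)
    simp only [smul_eq_mul] at this
    rw [show (v - z) / (v - u) * u + (z - u) / (v - u) * v = z by field_simp; ring] at this
    have hle : q z ≤ (v - z) / (v - u) * q u + (z - u) / (v - u) * q v := by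
      have h3 := mul_le_mul_of_nonneg_left this hk.le
      have e : (v - z) / (v - u) * q u + (z - u) / (v - u) * q v =
          -(p - 1) * (1 - z) + p * (1 - c) - p * (1 - c) *
          ((v - z) / (v - u) * u ^ (p - 1) + (z - u) / (v - u) * v ^ (p - 1)) := by
        simp only [hq]
        field_simp
        ring
      rw [e]
      simp only [hq]
      linarith
    have h1 : (v - z) / (v - u) * q u ≤ 0 :=
      mul_nonpos_of_nonneg_of_nonpos (by apply div_nonneg <;> linarith) hqu.le
    have h2 : (z - u) / (v - u) * q v < 0 :=
      mul_neg_of_pos_of_neg (by apply div_pos <;> linarith) hqv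
    linarith
  obtain ⟨y, hy, hy0⟩ := intermediate_value_Ioo' hc.1.le hcont.continuousOn ⟨hqc, hq0⟩
  refine ⟨y, hy, hy0, fun z hz hz0 => ?_⟩
  change q z = 0 at hz0
  rcases lt_trichotomy z y with h | h | h
  · exact absurd hy0 (hconv z y c hz.1.le h hy.2 hz0 hqc).ne
  · exact h
  · exact absurd hz0 (hconv y z c hy.1.le h hz.2 hy0 hqc).ne

theorem existsUnique_beta_root (hp2 : 2 < p) (hc : c ∈ Ioo (0 : ℝ) 1)
    (hpc : p * c < p - 1) (hpc' : p * (1 - c) ^ (p - 1) < 1) :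
    ∃ y ∈ Ioo c 1, -(p * c) * (1 - y) ^ (p - 1) - (p - 1) * y + p * c = 0 ∧
      ∀ z ∈ Ioo c 1, -(p * c) * (1 - z) ^ (p - 1) - (p - 1) * z + p * c = 0 → z = y := by
  set q : ℝ → ℝ := fun z => -(p * c) * (1 - z) ^ (p - 1) - (p - 1) * z + p * c with hq
  have hk : 0 < p * c := mul_pos (by linarith) hc.1
  have hcont : Continuous q := by
    have : Continuous fun z : ℝ => (1 - z) ^ (p - 1) :=
      (continuous_const.sub continuous_id).rpow_const fun _ => Or.inr (by linarith)
    fun_prop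
  have hq1 : q 1 < 0 := by
    simp only [hq, sub_self, Real.zero_rpow (show p - 1 ≠ 0 by linarith)]
    linarith
  have hqc : 0 < q c := by
    have : q c = c * (1 - p * (1 - c) ^ (p - 1)) := by simp only [hq]; ring
    rw [this]
    exact mul_pos hc.1 (by linarith)
  -- Here (1-z)^(p-1) is convex, so q is concave; with q c > 0 it is positive before any zero.
  have hconv : ∀ z v : ℝ, c < z → z < v → v < 1 → q v = 0 → 0 < q z := by
    intro z v huz hzv hv1 hqv
    have hcon := (convexOn_rpow (p := p - 1) (by linarith))
    have hv : 0 < v - c := by linarith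
    have := hcon.2 (show (0 : ℝ) ≤ 1 - c by linarith [hc.2])
      (show (0 : ℝ) ≤ 1 - v by linarith)
      (show 0 ≤ (v - z) / (v - c) by apply div_nonneg <;> linarith)
      (show 0 ≤ (z - c) / (v - c) by apply div_nonneg <;> linarith) (by field_simp; ring)
    simp only [smul_eq_mul] at this
    rw [show (v - z) / (v - c) * (1 - c) + (z - c) / (v - c) * (1 - v) = 1 - z by
      field_simp; ring] at this
    have hle : (v - z) / (v - c) * q c + (z - c) / (v - c) * q v ≤ q z := by
      have h3 := mul_le_mul_of_nonneg_left this hk.le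
      have e : (v - z) / (v - c) * q c + (z - c) / (v - c) * q v =
          -(p * c) * ((v - z) / (v - c) * (1 - c) ^ (p - 1) + (z - c) / (v - c) * (1 - v) ^ (p - 1))
          - (p - 1) * z + p * c := by
        simp only [hq]
        field_simp
        ring
      rw [e]
      simp only [hq]
      linarith
    have h1 : 0 < (v - z) / (v - c) * q c := mul_pos (by apply div_pos <;> linarith) hqc
    rw [hqv] at hle
    linarith
  obtain ⟨y, hy, hy0⟩ := intermediate_value_Ioo' hc.2.le hcont.continuousOn ⟨hq1, hqc⟩
  refine ⟨y, hy, hy0, fun z hz hz0 => ?_⟩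
  change q z = 0 at hz0
  rcases lt_trichotomy z y with h | h | h
  · exact absurd hz0 (hconv z y hz.1 h hy.2 hy0).ne'
  · exact h
  · exact absurd hy0 (hconv y z hy.1 h hz.2 hz0).ne'

end Lines

/-! ### Lower bounds from two-power test functions -/

theorem weightedInt_of_powers {p a A B u v : ℝ} {g : ℝ → ℝ} (hu : -1 < u) (hv : v < -1)
    (hA : 0 ≤ A) (hB : 0 ≤ B) (h1 : ∀ t ∈ Ioc (0 : ℝ) 1, |g t| ^ p * t ^ a = B * t ^ u)
    (h2 : ∀ t ∈ Ioi (1 : ℝ), |g t| ^ p * t ^ a = A * t ^ v) :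
    weightedInt p a g = ENNReal.ofReal (B / (u + 1) + A / (-(v + 1))) := by
  rw [weightedInt, ← Ioc_union_Ioi_eq_Ioi (zero_le_one' ℝ),
    lintegral_union measurableSet_Ioi (Ioc_disjoint_Ioi le_rfl),
    setLIntegral_congr_fun (g := fun t => ENNReal.ofReal (B * t ^ u)) measurableSet_Ioc
      (fun t ht => by simp only [h1 t ht]),
    setLIntegral_congr_fun (g := fun t => ENNReal.ofReal (A * t ^ v)) measurableSet_Ioi
      (fun t ht => by simp only [h2 t ht]),
    ← ofReal_integral_eq_lintegral_ofReal, ← ofReal_integral_eq_lintegral_ofReal,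
    ← ENNReal.ofReal_add]
  · rw [integral_const_mul, integral_const_mul, ← intervalIntegral.integral_of_le zero_le_one,
      integral_rpow (Or.inl hu), integral_Ioi_rpow_of_lt hv one_pos, Real.one_rpow, Real.one_rpow,
      Real.zero_rpow (by linarith), sub_zero]
    congr 1
    rw [div_neg, neg_div]
    ring
  · exact setIntegral_nonneg measurableSet_Ioc fun t ht =>
      mul_nonneg hB (Real.rpow_nonneg ht.1.le _)
  · exact setIntegral_nonneg measurableSet_Ioi fun t ht =>
      mul_nonneg hA (Real.rpow_nonneg (zero_le_one.trans (le_of_lt ht)) _)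
  · exact (integrableOn_Ioi_rpow_of_lt hv one_pos).const_mul A
  · exact (ae_restrict_iff' measurableSet_Ioi).2 <| Filter.Eventually.of_forall fun t ht =>
      mul_nonneg hA (Real.rpow_nonneg (zero_le_one.trans (le_of_lt ht)) _)
  · exact ((intervalIntegrable_iff_integrableOn_Ioc_of_le zero_le_one).1
      (intervalIntegral.intervalIntegrable_rpow' hu)).const_mul B
  · exact (ae_restrict_iff' measurableSet_Ioc).2 <| Filter.Eventually.of_forall fun t ht =>
      mul_nonneg hB (Real.rpow_nonneg ht.1.le _)

/-- The function `f` with `f / Hf` equal to `y` on `(0, 1]` and to `x` on `(1, ∞)`. -/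
noncomputable def powerPair (x y t : ℝ) : ℝ :=
  if t ≤ 1 then y * t ^ (y - 1) else x * t ^ (x - 1)

section PowerPair

variable {x y : ℝ}

theorem powerPair_of_le {t : ℝ} (ht : t ≤ 1) : powerPair x y t = y * t ^ (y - 1) := if_pos ht

theorem powerPair_of_lt {t : ℝ} (ht : 1 < t) : powerPair x y t = x * t ^ (x - 1) :=
  if_neg ht.not_ge

theorem powerPair_nonneg (hx : 0 ≤ x) (hy : 0 ≤ y) {t : ℝ} (ht : 0 < t) :
    0 ≤ powerPair x y t := by
  unfold powerPair
  split_ifs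
  · exact mul_nonneg hy (Real.rpow_nonneg ht.le _)
  · exact mul_nonneg hx (Real.rpow_nonneg ht.le _)

theorem powerPair_antitoneOn (hx : 0 ≤ x) (hxy : x ≤ y) (hy1 : y ≤ 1) :
    AntitoneOn (powerPair x y) (Ioi 0) := by
  intro s hs t ht hst
  have hs0 : (0 : ℝ) < s := hs
  rcases le_or_gt t 1 with h1 | h1
  · rw [powerPair_of_le h1, powerPair_of_le (hst.trans h1)]
    exact mul_le_mul_of_nonneg_left
      (Real.rpow_le_rpow_of_nonpos hs0 hst (by linarith)) (hx.trans hxy)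
  · rw [powerPair_of_lt h1]
    rcases le_or_gt s 1 with h2 | h2
    · rw [powerPair_of_le h2]
      have e1 : t ^ (x - 1) ≤ 1 := Real.rpow_le_one_of_one_le_of_nonpos h1.le (by linarith)
      have e2 : 1 ≤ s ^ (y - 1) :=
        Real.one_le_rpow_of_pos_of_le_one_of_nonpos hs0 h2 (by linarith)
      exact mul_le_mul hxy (e1.trans e2) (Real.rpow_nonneg (hs0.le.trans hst) _) (hx.trans hxy)
    · rw [powerPair_of_lt h2]
      exact mul_le_mul_of_nonneg_left
        (Real.rpow_le_rpow_of_nonpos hs0 hst (by linarith)) hx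

theorem hasIntegral_powerPair_of_le (hy : 0 < y) {t : ℝ} (ht : 0 < t) (ht1 : t ≤ 1) :
    IntervalIntegrable (powerPair x y) volume 0 t ∧ ∫ s in (0 : ℝ)..t, powerPair x y s = t ^ y := by
  have he : EqOn (powerPair x y) (fun s => y * s ^ (y - 1)) (uIcc 0 t) := fun s hs => by
    rw [uIcc_of_le ht.le] at hs
    exact powerPair_of_le (hs.2.trans ht1)
  constructor
  · refine ((intervalIntegral.intervalIntegrable_rpow' (show -1 < y - 1 by linarith)).const_mul y).congr ?_
    exact fun s hs => (he (uIoc_subset_uIcc hs)).symm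
  · rw [intervalIntegral.integral_congr he, intervalIntegral.integral_const_mul,
      integral_rpow (Or.inl (by linarith)), sub_add_cancel, Real.zero_rpow hy.ne']
    field_simp
    ring

/-- The primitives t^y and t^x agree at t = 1, so no constant of integration appears and f/Hf is
exactly x beyond 1. -/
theorem integral_powerPair_of_lt (hy : 0 < y) {t : ℝ} (ht1 : 1 < t) :
    ∫ s in (0 : ℝ)..t, powerPair x y s = t ^ x := by
  obtain ⟨hi, h1⟩ := hasIntegral_powerPair_of_le (x := x) hy one_pos le_rfl
  have he : EqOn (powerPair x y) (fun s => x * s ^ (x - 1)) (uIoc 1 t) := fun s hs => by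
    rw [uIoc_of_le ht1.le] at hs
    exact powerPair_of_lt hs.1
  have hpos : ∀ s ∈ uIcc 1 t, s ≠ 0 := fun s hs => by
    rw [uIcc_of_le ht1.le] at hs
    linarith [hs.1]
  have hi0 : IntervalIntegrable (fun s => x * s ^ (x - 1)) volume 1 t := by
    refine ContinuousOn.intervalIntegrable (continuousOn_const.mul ?_)
    exact continuousOn_id.rpow_const fun s hs => Or.inl (hpos s hs)
  have hi2 : IntervalIntegrable (powerPair x y) volume 1 t := hi0.congr fun s hs => (he hs).symm
  have h2 : ∫ s in (1 : ℝ)..t, powerPair x y s = t ^ x - 1 := by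
    have : ∫ s in (1 : ℝ)..t, powerPair x y s = ∫ s in (1 : ℝ)..t, x * s ^ (x - 1) :=
      intervalIntegral.integral_congr_ae (Filter.Eventually.of_forall fun s hs => he hs)
    rw [this, intervalIntegral.integral_eq_sub_of_hasDerivAt (f := fun s => s ^ x)
      (fun s hs => Real.hasDerivAt_rpow_const (Or.inl (hpos s hs))) hi0, Real.one_rpow]
  rw [← intervalIntegral.integral_add_adjacent_intervals hi hi2, h1, h2, Real.one_rpow]
  ring

theorem hardyOp_powerPair_of_le (hy : 0 < y) {t : ℝ} (ht : 0 < t) (ht1 : t ≤ 1) :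
    hardyOp (powerPair x y) t = t ^ (y - 1) := by
  rw [hardyOp, (hasIntegral_powerPair_of_le hy ht ht1).2, Real.rpow_sub_one ht.ne']
  ring

theorem hardyOp_powerPair_of_lt (hy : 0 < y) {t : ℝ} (ht1 : 1 < t) :
    hardyOp (powerPair x y) t = t ^ (x - 1) := by
  rw [hardyOp, integral_powerPair_of_lt hy ht1, Real.rpow_sub_one (by linarith)]
  ring

end PowerPair

theorem abs_mul_rpow_rpow_mul_rpow {p a w e t : ℝ} (hw : 0 ≤ w) (ht : 0 < t) :
    |w * t ^ e| ^ p * t ^ a = w ^ p * t ^ (p * e + a) := by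
  rw [abs_of_nonneg (mul_nonneg hw (Real.rpow_nonneg ht.le _)),
    Real.mul_rpow hw (Real.rpow_nonneg ht.le _), ← Real.rpow_mul ht.le, mul_assoc,
    ← Real.rpow_add ht, mul_comm e]

/-- Test with `powerPair x y`: x < c < y is what makes its weighted integral converge at both ends.
The denominators p(y-c) and p(c-x) are cleared. -/
theorem le_rpow_mul_of_mem_admissibleConstants {p a c x y K : ℝ} (hp : 1 ≤ p)
    (hc : a = p - 1 - p * c) (hx : 0 ≤ x) (hxc : x < c) (hcy : c < y) (hy1 : y ≤ 1)
    (hK : K ∈ admissibleConstants p a) :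
    (y - c) * (1 - x) ^ p + (c - x) * (1 - y) ^ p ≤
      K ^ p * ((y - c) * x ^ p + (c - x) * y ^ p) := by
  have hy : 0 < y := by linarith
  have hp0 : 0 < p := by linarith
  have hdy : 0 < p * (y - c) := mul_pos hp0 (sub_pos.2 hcy)
  have hdx : 0 < p * (c - x) := mul_pos hp0 (sub_pos.2 hxc)
  have hu : -1 < p * (y - 1) + a := by rw [hc]; linarith
  have hv : p * (x - 1) + a < -1 := by rw [hc]; linarith
  have hf : weightedInt p a (powerPair x y)
      = ENNReal.ofReal (y ^ p / (p * (y - 1) + a + 1) + x ^ p / (-(p * (x - 1) + a + 1))) := by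
    refine weightedInt_of_powers hu hv (Real.rpow_nonneg hx _) (Real.rpow_nonneg hy.le _) ?_ ?_
    · intro t ht
      rw [powerPair_of_le ht.2, abs_mul_rpow_rpow_mul_rpow hy.le ht.1]
    · intro t ht
      rw [powerPair_of_lt ht, abs_mul_rpow_rpow_mul_rpow hx (one_pos.trans ht)]
  have hg : weightedInt p a (fun t => hardyOp (powerPair x y) t - powerPair x y t)
      = ENNReal.ofReal ((1 - y) ^ p / (p * (y - 1) + a + 1)
        + (1 - x) ^ p / (-(p * (x - 1) + a + 1))) := by
    refine weightedInt_of_powers hu hv (Real.rpow_nonneg (by linarith) _)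
      (Real.rpow_nonneg (by linarith) _) ?_ ?_
    · intro t ht
      rw [hardyOp_powerPair_of_le hy ht.1 ht.2, powerPair_of_le ht.2,
        ← abs_mul_rpow_rpow_mul_rpow (sub_nonneg.2 hy1) ht.1]
      ring_nf
    · intro t ht
      rw [hardyOp_powerPair_of_lt hy ht, powerPair_of_lt ht,
        ← abs_mul_rpow_rpow_mul_rpow (by linarith) (one_pos.trans ht)]
      ring_nf
  have key := hK.2 (powerPair x y) (fun t ht => powerPair_nonneg hx hy.le ht)
    (powerPair_antitoneOn hx (by linarith) hy1) (by rw [hf]; exact ENNReal.ofReal_lt_top)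
  have hKp : 0 ≤ K ^ p := Real.rpow_nonneg hK.1 _
  have e1 : p * (y - 1) + a + 1 = p * (y - c) := by rw [hc]; ring
  have e2 : -(p * (x - 1) + a + 1) = p * (c - x) := by rw [hc]; ring
  have hxp : 0 ≤ x ^ p := Real.rpow_nonneg hx _
  have hyp : 0 < y ^ p := Real.rpow_pos_of_pos hy _
  rw [hf, hg, e1, e2, ← ENNReal.ofReal_mul hKp,
    ENNReal.ofReal_le_ofReal_iff (mul_nonneg hKp (by positivity))] at key
  have hcx' : 0 < c - x := sub_pos.2 hxc
  have hyc' : 0 < y - c := sub_pos.2 hcy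
  have := mul_le_mul_of_nonneg_left key (show 0 ≤ p * (y - c) * (c - x) by positivity)
  have e3 : ∀ A B : ℝ, p * (y - c) * (c - x) * (B / (p * (y - c)) + A / (p * (c - x)))
      = (y - c) * A + (c - x) * B := by
    intro A B
    field_simp
    ring
  rw [e3, mul_left_comm, e3] at this
  exact this

theorem kFun_le_rpow_of_mem_admissibleConstants {p a x y K : ℝ} (hp : 1 ≤ p)
    (hx : 0 ≤ x) (hxc : x < (p - 1 - a) / p) (hcy : (p - 1 - a) / p < y) (hy1 : y ≤ 1)
    (hK : K ∈ admissibleConstants p a) : kFun p a x y ≤ K ^ p := by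
  have hy : 0 < y := by linarith
  have := le_rpow_mul_of_mem_admissibleConstants hp
    (show a = p - 1 - p * ((p - 1 - a) / p) by field_simp; ring) hx hxc hcy hy1 hK
  rw [kFun, abs_of_nonneg hx, abs_of_pos hy, abs_sub_comm, abs_sub_comm y,
    abs_of_nonneg (show 0 ≤ 1 - x by linarith), abs_of_nonneg (show 0 ≤ 1 - y by linarith)]
  refine (div_le_iff₀ ?_).2 this
  exact add_pos_of_nonneg_of_pos (mul_nonneg (by linarith) (Real.rpow_nonneg hx _))
    (mul_pos (by linarith) (Real.rpow_pos_of_pos hy _))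

/-- The formal extremal t^(c-1) has infinite weighted integral, so it is approached by the exponents
c - e and c + e. The common factor e cancels before e → 0. -/
theorem div_rpow_le_rpow_of_mem_admissibleConstants {p a c K : ℝ} (hp : 1 ≤ p)
    (hc : a = p - 1 - p * c) (hc0 : 0 < c) (hc1 : c < 1) (hK : K ∈ admissibleConstants p a) :
    ((1 - c) / c) ^ p ≤ K ^ p := by
  have hlim : ∀ {w : ℝ → ℝ}, Continuous w → Filter.Tendsto w (nhdsWithin 0 (Ioi 0)) (nhds (w 0)) :=
    fun hw => (hw.tendsto 0).mono_left nhdsWithin_le_nhds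
  have hcont : ∀ {w : ℝ → ℝ}, Continuous w → Continuous fun e => w e ^ p :=
    fun hw => hw.rpow_const fun _ => Or.inr (by linarith)
  have h := le_of_tendsto_of_tendsto
    (hlim (w := fun e : ℝ => (1 - (c - e)) ^ p + (1 - (c + e)) ^ p)
      ((hcont (by fun_prop)).add (hcont (by fun_prop))))
    (hlim (w := fun e : ℝ => K ^ p * ((c - e) ^ p + (c + e) ^ p))
      (continuous_const.mul ((hcont (by fun_prop)).add (hcont (by fun_prop)))))
    (by
      filter_upwards [Ioo_mem_nhdsGT (show (0 : ℝ) < min c (1 - c) from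
        lt_min hc0 (sub_pos.2 hc1))] with e he
      have he1 := lt_min_iff.1 he.2
      have := le_rpow_mul_of_mem_admissibleConstants (x := c - e) (y := c + e) hp hc
        (by linarith) (by linarith [he.1]) (by linarith [he.1]) (by linarith) hK
      rw [add_sub_cancel_left, sub_sub_cancel, ← mul_add, ← mul_add, mul_left_comm] at this
      exact le_of_mul_le_mul_left this he.1)
  simp only [sub_zero, add_zero] at h
  rw [Real.div_rpow (by linarith) hc0.le, div_le_iff₀ (Real.rpow_pos_of_pos hc0 _)]
  linarith

/-! ### Upper bound: integrating the line along f/Hf -/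

section Decreasing

variable {p a c : ℝ} {f : ℝ → ℝ}

/-- By monotonicity f(t)^p t^(a+1)/(a+1) ≤ ∫₀ᵗ f^p s^a, which tends to 0 with t. Since a+1 = (1-c)p,
this says f = o(t^(c-1)) at 0. -/
theorem exists_forall_le_mul_rpow (hp : 1 ≤ p) (hc : a = p - 1 - p * c) (hc1 : c < 1)
    (hf0 : ∀ t ∈ Ioi (0 : ℝ), 0 ≤ f t) (hf : AntitoneOn f (Ioi 0)) (hW : weightedInt p a f < ⊤)
    {e : ℝ} (he : 0 < e) : ∃ d > 0, ∀ t ∈ Ioc 0 d, f t ≤ e * t ^ (c - 1) := by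
  have hp0 : 0 < p := by linarith
  have ha1 : 0 < a + 1 := by rw [hc]; nlinarith
  have hlim : Filter.Tendsto (fun t : ℝ => ∫⁻ s in Ioc 0 t, ENNReal.ofReal (|f s| ^ p * s ^ a)
      ∂(volume.restrict (Ioi 0))) (nhdsWithin 0 (Ioi 0)) (nhds 0) := by
    refine tendsto_setLIntegral_zero hW.ne ?_
    have h0 : Filter.Tendsto (fun t : ℝ => ENNReal.ofReal t) (nhdsWithin 0 (Ioi 0)) (nhds 0) := by
      have := (ENNReal.continuous_ofReal.tendsto 0).mono_left
        (nhdsWithin_le_nhds (a := (0 : ℝ)) (s := Ioi 0))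
      simpa using this
    refine tendsto_of_tendsto_of_tendsto_of_le_of_le tendsto_const_nhds h0 (fun _ => zero_le)
      fun t => ?_
    calc volume.restrict (Ioi 0) (Ioc 0 t) ≤ volume (Ioc 0 t) := Measure.restrict_apply_le _ _
      _ = ENNReal.ofReal t := by rw [Real.volume_Ioc, sub_zero]
  have hep : 0 < e ^ p / (a + 1) := div_pos (Real.rpow_pos_of_pos he _) ha1
  have hev := hlim.eventually (gt_mem_nhds (ENNReal.ofReal_pos.2 hep))
  obtain ⟨d, hd, hdt⟩ := mem_nhdsGT_iff_exists_Ioc_subset.1 hev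
  refine ⟨d, hd, fun t ht => ?_⟩
  have ht0 := ht.1
  have hft := hf0 t ht0
  have h1 : ∫⁻ s in Ioc 0 t, ENNReal.ofReal (|f s| ^ p * s ^ a) < ENNReal.ofReal (e ^ p / (a + 1)) := by
    have : Ioc 0 t ∩ Ioi 0 = Ioc 0 t := inter_eq_left.2 fun s hs => hs.1
    simpa [Measure.restrict_restrict measurableSet_Ioc, this] using hdt ht
  have h2 : ENNReal.ofReal (f t ^ p * (t ^ (a + 1) / (a + 1)))
      ≤ ∫⁻ s in Ioc 0 t, ENNReal.ofReal (|f s| ^ p * s ^ a) := by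
    calc ENNReal.ofReal (f t ^ p * (t ^ (a + 1) / (a + 1)))
        = ∫⁻ s in Ioc 0 t, ENNReal.ofReal (f t ^ p * s ^ a) := by
          rw [← ofReal_integral_eq_lintegral_ofReal, integral_const_mul,
            ← intervalIntegral.integral_of_le ht0.le, integral_rpow (Or.inl (by linarith)),
            Real.zero_rpow ha1.ne', sub_zero]
          · exact ((intervalIntegrable_iff_integrableOn_Ioc_of_le ht0.le).1
              (intervalIntegral.intervalIntegrable_rpow' (by linarith))).const_mul _
          · exact (ae_restrict_iff' measurableSet_Ioc).2 <| Filter.Eventually.of_forall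
              fun s hs => mul_nonneg (Real.rpow_nonneg hft _) (Real.rpow_nonneg hs.1.le _)
      _ ≤ _ := by
          refine setLIntegral_mono' measurableSet_Ioc fun s hs => ENNReal.ofReal_le_ofReal ?_
          refine mul_le_mul_of_nonneg_right (Real.rpow_le_rpow hft ?_ hp0.le)
            (Real.rpow_nonneg hs.1.le _)
          exact (hf hs.1 ht0 hs.2).trans (le_abs_self _)
  have h3 := (ENNReal.ofReal_lt_ofReal_iff hep).1 (h2.trans_lt h1)
  rw [← mul_div_assoc, div_lt_div_iff_of_pos_right ha1,
    show a + 1 = (1 - c) * p by rw [hc]; ring, Real.rpow_mul ht0.le,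
    ← Real.mul_rpow hft (Real.rpow_nonneg ht0.le _)] at h3
  have h4 := (Real.rpow_lt_rpow_iff (mul_nonneg hft (Real.rpow_nonneg ht0.le _)) he.le hp0).1 h3
  rw [show c - 1 = -(1 - c) by ring, Real.rpow_neg ht0.le, ← div_eq_mul_inv,
    le_div_iff₀ (Real.rpow_pos_of_pos ht0 _)]
  exact h4.le

/-- Since c > 0, t^(c-1) is integrable at 0. This ensures that the integral in `hardyOp` is a true
one and not the default value 0. -/
theorem intervalIntegrable_of_le_mul_rpow (hc0 : 0 < c) (hf0 : ∀ t ∈ Ioi (0 : ℝ), 0 ≤ f t)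
    (hf : AntitoneOn f (Ioi 0)) {e d : ℝ} (hd : 0 < d)
    (hle : ∀ t ∈ Ioc 0 d, f t ≤ e * t ^ (c - 1)) {t : ℝ} (ht : 0 < t) :
    IntervalIntegrable f volume 0 t := by
  have h1 : IntervalIntegrable f volume 0 d := by
    have hg : IntervalIntegrable (fun t => e * t ^ (c - 1)) volume 0 d :=
      (intervalIntegral.intervalIntegrable_rpow' (show -1 < c - 1 by linarith)).const_mul e
    rw [intervalIntegrable_iff_integrableOn_Ioc_of_le hd.le] at hg ⊢
    refine Integrable.mono' hg (aemeasurable_restrict_of_antitoneOn measurableSet_Ioc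
      (hf.mono fun s hs => hs.1)).aestronglyMeasurable ?_
    refine (ae_restrict_iff' measurableSet_Ioc).2 <| Filter.Eventually.of_forall fun s hs => ?_
    rw [Real.norm_of_nonneg (hf0 s hs.1)]
    exact hle s hs
  refine h1.trans (AntitoneOn.intervalIntegrable (hf.mono fun s hs => ?_))
  exact (lt_min hd ht).trans_le hs.1

theorem le_hardyOp (hf : AntitoneOn f (Ioi 0)) {t : ℝ} (ht : 0 < t)
    (hi : IntervalIntegrable f volume 0 t) : f t ≤ hardyOp f t := by
  have : ∫ _ in (0 : ℝ)..t, f t ≤ ∫ s in (0 : ℝ)..t, f s :=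
    intervalIntegral.integral_mono_on_of_le_Ioo ht.le intervalIntegrable_const hi
      fun s hs => hf hs.1 ht hs.2.le
  rw [intervalIntegral.integral_const, sub_zero, smul_eq_mul] at this
  rw [hardyOp, one_div_mul_eq_div, le_div_iff₀ ht]
  linarith

theorem hardyOp_le_mul_rpow (hc0 : 0 < c) {e d : ℝ}
    (hle : ∀ t ∈ Ioc 0 d, f t ≤ e * t ^ (c - 1)) {t : ℝ} (ht : t ∈ Ioc 0 d)
    (hi : IntervalIntegrable f volume 0 t) : hardyOp f t ≤ e / c * t ^ (c - 1) := by
  have ht0 := ht.1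
  have hg : IntervalIntegrable (fun t => e * t ^ (c - 1)) volume 0 t :=
    (intervalIntegral.intervalIntegrable_rpow' (show -1 < c - 1 by linarith)).const_mul e
  have : ∫ s in (0 : ℝ)..t, f s ≤ ∫ s in (0 : ℝ)..t, e * s ^ (c - 1) :=
    intervalIntegral.integral_mono_on_of_le_Ioo ht0.le hi hg
      fun s hs => hle s ⟨hs.1, hs.2.le.trans ht.2⟩
  rw [intervalIntegral.integral_const_mul, integral_rpow (Or.inl (by linarith)), sub_add_cancel,
    Real.zero_rpow hc0.ne', sub_zero] at this
  rw [hardyOp, one_div_mul_eq_div, div_le_iff₀ ht0, Real.rpow_sub_one ht0.ne']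
  calc _ ≤ _ := this
    _ = _ := by field_simp

theorem continuousOn_hardyOp (hi : ∀ t, 0 < t → IntervalIntegrable f volume 0 t) :
    ContinuousOn (hardyOp f) (Ioi 0) := by
  intro t ht
  have ht0 : (0 : ℝ) < t := ht
  refine ContinuousAt.continuousWithinAt ?_
  unfold hardyOp
  refine (continuousAt_const.div continuousAt_id ht0.ne').mul ?_
  have h2 : (0 : ℝ) < 2 * t := by linarith
  have := intervalIntegral.continuousOn_primitive_interval'
    (hi _ h2) (left_mem_uIcc (a := (0 : ℝ)) (b := 2 * t))
  refine this.continuousAt ?_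
  rw [uIcc_of_le h2.le]
  exact Icc_mem_nhds ht0 (by linarith)

theorem hasDerivAt_hardyOp (hf : AntitoneOn f (Ioi 0)) {t : ℝ} (ht : 0 < t)
    (hi : IntervalIntegrable f volume 0 t) (hft : ContinuousAt f t) :
    HasDerivAt (hardyOp f) ((f t - hardyOp f t) / t) t := by
  have h1 : HasDerivAt (fun u => ∫ s in (0 : ℝ)..u, f s) (f t) t := by
    refine intervalIntegral.integral_hasDerivAt_right hi ⟨Ioi 0, Ioi_mem_nhds ht, ?_⟩ hft
    exact (aemeasurable_restrict_of_antitoneOn measurableSet_Ioi hf).aestronglyMeasurable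
  have h2 : HasDerivAt (fun u : ℝ => 1 / u) (-(t ^ 2)⁻¹) t := by
    simpa using hasDerivAt_inv ht.ne'
  refine (h2.mul h1).congr_deriv ?_
  unfold hardyOp
  field_simp
  ring

theorem hasDerivAt_rpow_mul_hardyOp_rpow (hp : 1 ≤ p) (hc : a = p - 1 - p * c)
    (hf : AntitoneOn f (Ioi 0)) {t : ℝ} (ht : 0 < t) (hi : IntervalIntegrable f volume 0 t)
    (hft : ContinuousAt f t) (hF : 0 ≤ hardyOp f t) :
    HasDerivAt (fun u => u ^ (a + 1) * hardyOp f u ^ p)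
      (p * (t ^ a * (f t * hardyOp f t ^ (p - 1) - c * hardyOp f t ^ p))) t := by
  have h1 := (Real.hasDerivAt_rpow_const (p := a + 1) (Or.inl ht.ne')).mul
    ((hasDerivAt_hardyOp hf ht hi hft).rpow_const (p := p) (Or.inr hp))
  refine h1.congr_deriv ?_
  have e : hardyOp f t ^ p = hardyOp f t * hardyOp f t ^ (p - 1) := by
    rcases hp.eq_or_lt with rfl | hp
    · simp
    · exact rpow_eq_mul_rpow_sub_one hp hF
  rw [e, add_sub_cancel_right, Real.rpow_add_one ht.ne', hc]
  field_simp
  ring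

/-- The line inequality at z = x/y, made homogeneous by the factor y^p. -/
theorem rpow_sub_le_of_line (hp : 1 ≤ p) {M l x y : ℝ}
    (hline : ∀ z ∈ Icc (0 : ℝ) 1, (1 - z) ^ p - M * z ^ p ≤ l * (z - c))
    (hx : 0 ≤ x) (hxy : x ≤ y) :
    (y - x) ^ p ≤ M * x ^ p + l * (x * y ^ (p - 1) - c * y ^ p) := by
  rcases (hx.trans hxy).eq_or_lt with h0 | hy
  · obtain rfl : x = 0 := by linarith
    rw [← h0, sub_self, Real.zero_rpow (by linarith)]
    simp
  · have h := hline (x / y) ⟨by positivity, (div_le_one hy).2 hxy⟩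
    have hyp : 0 < y ^ p := Real.rpow_pos_of_pos hy _
    have e1 : (1 - x / y) ^ p = (y - x) ^ p / y ^ p := by
      rw [← Real.div_rpow (by linarith) hy.le, sub_div, div_self hy.ne']
    rw [e1, Real.div_rpow hx hy.le] at h
    have h2 := mul_le_mul_of_nonneg_right h hyp.le
    have e2 : ((y - x) ^ p / y ^ p - M * (x ^ p / y ^ p)) * y ^ p = (y - x) ^ p - M * x ^ p := by
      field_simp
    have e3 : l * (x / y - c) * y ^ p = l * (x * y ^ (p - 1) - c * y ^ p) := by
      rw [Real.rpow_sub_one hy.ne']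
      field_simp
    rw [e2, e3] at h2
    linarith

theorem setLIntegral_hardyOp_sub_le (hp : 1 ≤ p) (hc : a = p - 1 - p * c) {M l : ℝ} (hM : 0 ≤ M)
    (hl : l ≤ 0) (hline : ∀ z ∈ Icc (0 : ℝ) 1, (1 - z) ^ p - M * z ^ p ≤ l * (z - c))
    (hf0 : ∀ t ∈ Ioi (0 : ℝ), 0 ≤ f t) (hf : AntitoneOn f (Ioi 0))
    (hi : ∀ t, 0 < t → IntervalIntegrable f volume 0 t) {u v : ℝ} (hu : 0 < u) (huv : u ≤ v) :
    ∫⁻ t in Ioc u v, ENNReal.ofReal (|hardyOp f t - f t| ^ p * t ^ a) ≤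
      ENNReal.ofReal M * weightedInt p a f
        + ENNReal.ofReal (-l / p * (u ^ (a + 1) * hardyOp f u ^ p)) := by
  have hp0 : 0 < p := by linarith
  have hsub : Icc u v ⊆ Ioi 0 := fun t ht => hu.trans_le ht.1
  have hfF : ∀ t, 0 < t → f t ≤ hardyOp f t := fun t ht => le_hardyOp hf ht (hi t ht)
  have hF0 : ∀ t, 0 < t → 0 ≤ hardyOp f t := fun t ht => (hf0 t ht).trans (hfF t ht)
  have hFc : ContinuousOn (hardyOp f) (Icc u v) := (continuousOn_hardyOp hi).mono hsub
  have htc : ∀ b : ℝ, ContinuousOn (fun t : ℝ => t ^ b) (Icc u v) := fun b =>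
    continuousOn_id.rpow_const fun t ht => Or.inl (hsub ht).ne'
  set D : ℝ → ℝ := fun t => t ^ a * (f t * hardyOp f t ^ (p - 1) - c * hardyOp f t ^ p) with hD
  set P : ℝ → ℝ := fun t => t ^ (a + 1) * hardyOp f t ^ p with hP
  have hiD : IntervalIntegrable D volume u v := by
    have hif : IntervalIntegrable f volume u v :=
      AntitoneOn.intervalIntegrable (by rw [uIcc_of_le huv]; exact hf.mono hsub)
    have h1 : ContinuousOn (fun t => hardyOp f t ^ (p - 1)) (uIcc u v) := by
      rw [uIcc_of_le huv]
      exact hFc.rpow_const fun t _ => Or.inr (by linarith)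
    have h2 : ContinuousOn (fun t => c * hardyOp f t ^ p) (uIcc u v) := by
      rw [uIcc_of_le huv]
      exact continuousOn_const.mul (hFc.rpow_const fun t _ => Or.inr hp0.le)
    exact ((hif.mul_continuousOn h1).sub h2.intervalIntegrable).continuousOn_mul
      (by rw [uIcc_of_le huv]; exact htc a)
  have hiN : IntervalIntegrable (fun t => f t ^ p * t ^ a) volume u v := by
    have : AntitoneOn (fun t => f t ^ p) (Icc u v) := fun s hs t ht hst =>
      Real.rpow_le_rpow (hf0 t (hsub ht)) (hf (hsub hs) (hsub ht) hst) hp0.le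
    exact (AntitoneOn.intervalIntegrable (by rw [uIcc_of_le huv]; exact this)).mul_continuousOn
      (by rw [uIcc_of_le huv]; exact htc a)
  -- f may jump, but a monotone function has only countably many discontinuities and P is
  -- continuous, so the fundamental theorem of calculus still applies.
  have hFTC : ∫ t in u..v, p * D t = P v - P u := by
    refine integral_eq_of_hasDerivAt_off_countable_of_le P (fun t => p * D t) huv
      hf.countable_not_continuousWithinAt ?_ (fun t ht => ?_) (hiD.const_mul p)
    · exact (htc (a + 1)).mul (hFc.rpow_const fun t _ => Or.inr hp0.le)
    · have ht0 : 0 < t := hu.trans ht.1.1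
      have hft : ContinuousAt f t := by
        have : ContinuousWithinAt f (Ioi 0) t := by
          by_contra hcon
          exact ht.2 ⟨ht0, hcon⟩
        exact this.continuousAt (Ioi_mem_nhds ht0)
      exact hasDerivAt_rpow_mul_hardyOp_rpow hp hc hf ht0 (hi t ht0) hft (hF0 t ht0)
  rw [intervalIntegral.integral_const_mul] at hFTC
  have hpt : ∀ t ∈ Ioc u v,
      |hardyOp f t - f t| ^ p * t ^ a ≤ M * (f t ^ p * t ^ a) + l * D t := by
    intro t ht
    have ht0 : 0 < t := hu.trans ht.1
    rw [abs_of_nonneg (sub_nonneg.2 (hfF t ht0))]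
    have := mul_le_mul_of_nonneg_right
      (rpow_sub_le_of_line hp hline (hf0 t ht0) (hfF t ht0)) (Real.rpow_nonneg ht0.le a)
    simp only [hD]
    linarith
  have hiR : IntervalIntegrable (fun t => M * (f t ^ p * t ^ a) + l * D t) volume u v :=
    (hiN.const_mul M).add (hiD.const_mul l)
  have hPv : 0 ≤ P v := mul_nonneg (Real.rpow_nonneg (hu.le.trans huv) _)
    (Real.rpow_nonneg (hF0 v (hu.trans_le huv)) _)
  calc ∫⁻ t in Ioc u v, ENNReal.ofReal (|hardyOp f t - f t| ^ p * t ^ a)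
      ≤ ∫⁻ t in Ioc u v, ENNReal.ofReal (M * (f t ^ p * t ^ a) + l * D t) :=
        setLIntegral_mono' measurableSet_Ioc fun t ht => ENNReal.ofReal_le_ofReal (hpt t ht)
    _ = ENNReal.ofReal (∫ t in u..v, (M * (f t ^ p * t ^ a) + l * D t)) := by
        rw [intervalIntegral.integral_of_le huv, ofReal_integral_eq_lintegral_ofReal]
        · exact (intervalIntegrable_iff_integrableOn_Ioc_of_le huv).1 hiR
        · refine (ae_restrict_iff' measurableSet_Ioc).2 <| Filter.Eventually.of_forall
            fun t ht => le_trans ?_ (hpt t ht)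
          exact mul_nonneg (Real.rpow_nonneg (abs_nonneg _) _)
            (Real.rpow_nonneg (hu.trans ht.1).le _)
    _ ≤ ENNReal.ofReal (M * (∫ t in u..v, f t ^ p * t ^ a) + -l / p * P u) := by
        refine ENNReal.ofReal_le_ofReal ?_
        rw [intervalIntegral.integral_add (hiN.const_mul M) (hiD.const_mul l),
          intervalIntegral.integral_const_mul, intervalIntegral.integral_const_mul]
        have e : l * ∫ t in u..v, D t = l / p * (P v - P u) := by
          rw [← hFTC]
          field_simp
        -- The boundary term at the upper end is dropped because l ≤ 0 and P v ≥ 0.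
        have : l / p * P v ≤ 0 :=
          mul_nonpos_of_nonpos_of_nonneg (div_nonpos_of_nonpos_of_nonneg hl hp0.le) hPv
        rw [e, neg_div]
        linarith
    _ ≤ ENNReal.ofReal (M * (∫ t in u..v, f t ^ p * t ^ a)) + ENNReal.ofReal (-l / p * P u) :=
        ENNReal.ofReal_add_le
    _ ≤ _ := by
        refine add_le_add_left ?_ _
        rw [ENNReal.ofReal_mul hM, intervalIntegral.integral_of_le huv,
          ofReal_integral_eq_lintegral_ofReal]
        · refine mul_le_mul_right ?_ _
          rw [weightedInt]
          calc ∫⁻ t in Ioc u v, ENNReal.ofReal (f t ^ p * t ^ a)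
              = ∫⁻ t in Ioc u v, ENNReal.ofReal (|f t| ^ p * t ^ a) :=
                setLIntegral_congr_fun measurableSet_Ioc fun t ht => by
                  simp only [abs_of_nonneg (hf0 t (hu.trans ht.1))]
            _ ≤ _ := lintegral_mono_set fun t ht => hu.trans ht.1
        · exact (intervalIntegrable_iff_integrableOn_Ioc_of_le huv).1 hiN
        · refine (ae_restrict_iff' measurableSet_Ioc).2 <| Filter.Eventually.of_forall fun t ht => ?_
          exact mul_nonneg (Real.rpow_nonneg (hf0 t (hu.trans ht.1)) _)
            (Real.rpow_nonneg (hu.trans ht.1).le _)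

/-- The boundary term at 0 vanishes: f = o(t^(c-1)) passes to Hf on integration, and the p-th power
of t^(c-1) is t^(-(a+1)). -/
theorem exists_forall_rpow_mul_hardyOp_le (hp : 1 ≤ p) (hc : a = p - 1 - p * c) (hc0 : 0 < c)
    (hc1 : c < 1) (hf0 : ∀ t ∈ Ioi (0 : ℝ), 0 ≤ f t) (hf : AntitoneOn f (Ioi 0))
    (hW : weightedInt p a f < ⊤) (hi : ∀ t, 0 < t → IntervalIntegrable f volume 0 t)
    {e : ℝ} (he : 0 < e) :
    ∃ d > 0, ∀ t ∈ Ioc 0 d, t ^ (a + 1) * hardyOp f t ^ p ≤ e := by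
  have hp0 : 0 < p := by linarith
  have he' : 0 < c * e ^ (1 / p) := mul_pos hc0 (Real.rpow_pos_of_pos he _)
  obtain ⟨d, hd, hle⟩ := exists_forall_le_mul_rpow hp hc hc1 hf0 hf hW he'
  refine ⟨d, hd, fun t ht => ?_⟩
  have ht0 := ht.1
  have hF := hardyOp_le_mul_rpow hc0 hle ht (hi t ht0)
  have hF0 : 0 ≤ hardyOp f t := (hf0 t ht0).trans (le_hardyOp hf ht0 (hi t ht0))
  rw [mul_div_cancel_left₀ _ hc0.ne', show c - 1 = -(1 - c) by ring, Real.rpow_neg ht0.le,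
    ← div_eq_mul_inv, le_div_iff₀ (Real.rpow_pos_of_pos ht0 _)] at hF
  calc t ^ (a + 1) * hardyOp f t ^ p = (hardyOp f t * t ^ (1 - c)) ^ p := by
        rw [Real.mul_rpow hF0 (Real.rpow_nonneg ht0.le _), ← Real.rpow_mul ht0.le, mul_comm,
          show (1 - c) * p = a + 1 by rw [hc]; ring]
    _ ≤ (e ^ (1 / p)) ^ p :=
        Real.rpow_le_rpow (mul_nonneg hF0 (Real.rpow_nonneg ht0.le _)) hF hp0.le
    _ = e := by rw [← Real.rpow_mul he.le, one_div_mul_cancel hp0.ne', Real.rpow_one]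

theorem weightedInt_hardyOp_sub_le (hp : 1 ≤ p) (hc : a = p - 1 - p * c) (hc0 : 0 < c)
    (hc1 : c < 1) {M l : ℝ} (hM : 0 ≤ M)
    (hline : ∀ z ∈ Icc (0 : ℝ) 1, (1 - z) ^ p - M * z ^ p ≤ l * (z - c))
    (hf0 : ∀ t ∈ Ioi (0 : ℝ), 0 ≤ f t) (hf : AntitoneOn f (Ioi 0)) (hW : weightedInt p a f < ⊤) :
    weightedInt p a (fun t => hardyOp f t - f t) ≤ ENNReal.ofReal M * weightedInt p a f := by
  have hp0 : 0 < p := by linarith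
  -- The line inequality at z = 0 reads 1 ≤ -l c.
  have hl : l ≤ 0 := by
    have := hline 0 ⟨le_rfl, zero_le_one⟩
    rw [Real.zero_rpow hp0.ne', sub_zero, Real.one_rpow] at this
    nlinarith
  have hi : ∀ t, 0 < t → IntervalIntegrable f volume 0 t := by
    obtain ⟨d, hd, hle⟩ := exists_forall_le_mul_rpow hp hc hc1 hf0 hf hW one_pos
    exact fun t ht => intervalIntegrable_of_le_mul_rpow hc0 hf0 hf hd hle ht
  refine ENNReal.le_of_forall_pos_le_add fun e he _ => ?_
  -- The boundary term carries the factor -l/p; the added 1 keeps the divisor positive.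
  have he' : 0 < e / (-l / p + 1) := by
    have : 0 ≤ -l / p := div_nonneg (by linarith) hp0.le
    positivity
  obtain ⟨d, hd, hdt⟩ := exists_forall_rpow_mul_hardyOp_le hp hc hc0 hc1 hf0 hf hW hi he'
  have hU : Ioi (0 : ℝ) = ⋃ n : ℕ, Ioc (d / (n + 1)) (d + n) := by
    ext t
    simp only [mem_Ioi, mem_iUnion, mem_Ioc]
    constructor
    · intro ht
      obtain ⟨n, hn⟩ := exists_nat_gt (max (d / t) t)
      have hn1 := (le_max_left _ _).trans_lt hn
      have hn2 := (le_max_right _ _).trans_lt hn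
      refine ⟨n, ?_, by linarith⟩
      rw [div_lt_iff₀ ht] at hn1
      rw [div_lt_iff₀ (by positivity)]
      linarith
    · rintro ⟨n, hn, -⟩
      exact lt_trans (by positivity) hn
  have hmono : Monotone fun n : ℕ => Ioc (d / ((n : ℝ) + 1)) (d + n) := by
    intro m n hmn
    have : (m : ℝ) ≤ n := by exact_mod_cast hmn
    refine Ioc_subset_Ioc ?_ (by linarith)
    gcongr
  rw [weightedInt, hU, setLIntegral_iUnion_of_directed _ hmono.directed_le]
  refine iSup_le fun n => ?_
  have hn : (0 : ℝ) ≤ n := Nat.cast_nonneg n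
  have hdn : d / ((n : ℝ) + 1) ≤ d := div_le_self hd.le (by linarith)
  have hdn0 : 0 < d / ((n : ℝ) + 1) := by positivity
  refine (setLIntegral_hardyOp_sub_le hp hc hM hl hline hf0 hf hi hdn0 (by linarith)).trans ?_
  refine add_le_add_right ?_ _
  rw [← ENNReal.ofReal_coe_nnreal]
  refine ENNReal.ofReal_le_ofReal ?_
  have hlp : 0 ≤ -l / p := div_nonneg (by linarith) hp0.le
  calc -l / p * _ ≤ -l / p * (e / (-l / p + 1)) :=
        mul_le_mul_of_nonneg_left (hdt _ ⟨hdn0, hdn⟩) hlp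
    _ ≤ (-l / p + 1) * (e / (-l / p + 1)) := mul_le_mul_of_nonneg_right (by linarith) he'.le
    _ = e := by rw [← mul_div_assoc, mul_div_cancel_left₀ _ (show 0 < -l / p + 1 by linarith).ne']

end Decreasing

/-! ### Matching the bounds and translating the thresholds -/

/-- A line through `(c, 0)` above `(1 - x)^p - M x^p` bounds the best constant from above. -/
theorem isLeast_of_line {p a c M l : ℝ} (hp : 1 ≤ p) (hc : a = p - 1 - p * c) (hc0 : 0 < c)
    (hc1 : c < 1) (hM : 0 ≤ M)
    (hline : ∀ z ∈ Icc (0 : ℝ) 1, (1 - z) ^ p - M * z ^ p ≤ l * (z - c))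
    (hlower : ∀ K ∈ admissibleConstants p a, M ≤ K ^ p) :
    IsLeast (admissibleConstants p a) (bestConstant p a) ∧ bestConstant p a ^ p = M := by
  have hp0 : 0 < p := by linarith
  have hroot : (M ^ (1 / p)) ^ p = M := by
    rw [← Real.rpow_mul hM, one_div_mul_cancel hp0.ne', Real.rpow_one]
  have hleast : IsLeast (admissibleConstants p a) (M ^ (1 / p)) := by
    refine ⟨⟨Real.rpow_nonneg hM _, fun f hf0 hf hW => ?_⟩, fun K hK => ?_⟩
    · rw [hroot]
      exact weightedInt_hardyOp_sub_le hp hc hc0 hc1 hM hline hf0 hf hW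
    · have := hlower K hK
      rwa [← hroot, Real.rpow_le_rpow_iff (Real.rpow_nonneg hM _) hK.1 hp0] at this
  have heq : bestConstant p a = M ^ (1 / p) := hleast.csInf_eq
  rw [heq]
  exact ⟨hleast, hroot⟩

theorem rpow_mul_rpow_sub_one_rpow {p x : ℝ} (hp : 1 < p) (hx : 0 < x) :
    (p * x) ^ (p - 1) = p ^ (p - 2) * (p * x ^ (p - 1)) ∧
      (p ^ ((p - 2) / (p - 1))) ^ (p - 1) = p ^ (p - 2) := by
  have hp0 : 0 < p := by linarith
  have hp1 : p - 1 ≠ 0 := by linarith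
  constructor
  · rw [Real.mul_rpow hp0.le hx.le, show p - 1 = p - 2 + 1 by ring, Real.rpow_add_one hp0.ne']
    ring
  · rw [← Real.rpow_mul hp0.le, div_mul_cancel₀ _ hp1]

/-- Raise to the power p-1. With x = c, where px = p-1-a, this turns the threshold in a for p ≤ 2
into the endpoint condition for the tangent at c; for p > 2 the strict version below is used with x
= 1-c, where px = 1+a. -/
theorem mul_le_threshold_iff {p x : ℝ} (hp : 1 < p) (hx : 0 < x) :
    p * x ≤ p ^ ((p - 2) / (p - 1)) ↔ p * x ^ (p - 1) ≤ 1 := by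
  have hp0 : 0 < p := by linarith
  obtain ⟨h1, h2⟩ := rpow_mul_rpow_sub_one_rpow hp hx
  rw [← Real.rpow_le_rpow_iff (z := p - 1) (by positivity) (Real.rpow_nonneg hp0.le _)
    (by linarith), h1, h2, mul_le_iff_le_one_right (Real.rpow_pos_of_pos hp0 _)]

theorem mul_lt_threshold_iff {p x : ℝ} (hp : 1 < p) (hx : 0 < x) :
    p * x < p ^ ((p - 2) / (p - 1)) ↔ p * x ^ (p - 1) < 1 := by
  have hp0 : 0 < p := by linarith
  obtain ⟨h1, h2⟩ := rpow_mul_rpow_sub_one_rpow hp hx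
  rw [← Real.rpow_lt_rpow_iff (z := p - 1) (by positivity) (Real.rpow_nonneg hp0.le _)
    (by linarith), h1, h2, mul_lt_iff_lt_one_right (Real.rpow_pos_of_pos hp0 _)]

/-! ### The best constant in each configuration -/

section Cases

variable {p a c : ℝ}

theorem kFun_eq (hc : c = (p - 1 - a) / p) {x y : ℝ} (hx : 0 ≤ x) (hx1 : x ≤ 1) (hy : 0 ≤ y)
    (hy1 : y ≤ 1) : kFun p a x y = ((y - c) * (1 - x) ^ p + (c - x) * (1 - y) ^ p) /
      ((y - c) * x ^ p + (c - x) * y ^ p) := by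
  rw [kFun, ← hc, abs_sub_comm, abs_sub_comm y, abs_of_nonneg hx, abs_of_nonneg hy,
    abs_of_nonneg (sub_nonneg.2 hx1), abs_of_nonneg (sub_nonneg.2 hy1)]

theorem kFun_zero_one (hp : 1 ≤ p) (hc : c = (p - 1 - a) / p) :
    kFun p a 0 1 = (1 - c) / c := by
  rw [kFun_eq hc le_rfl zero_le_one zero_le_one le_rfl, sub_self, Real.zero_rpow (by linarith)]
  simp

theorem isLeast_chord (hp : 1 ≤ p) (hc : c = (p - 1 - a) / p) (hc01 : c ∈ Ioo (0 : ℝ) 1)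
    (hline : ∀ z ∈ Icc (0 : ℝ) 1, (1 - z) ^ p - (1 - c) / c * z ^ p ≤ -1 / c * (z - c)) :
    IsLeast (admissibleConstants p a) (bestConstant p a) ∧
      bestConstant p a ^ p = (1 - c) / c := by
  have hac : a = p - 1 - p * c := by rw [hc]; field_simp; ring
  refine isLeast_of_line hp hac hc01.1 hc01.2
    (div_nonneg (sub_nonneg.2 hc01.2.le) hc01.1.le) hline fun K hK => ?_
  rw [← kFun_zero_one hp hc]
  exact kFun_le_rpow_of_mem_admissibleConstants hp le_rfl (hc ▸ hc01.1) (hc ▸ hc01.2) le_rfl hK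

theorem isLeast_tangent (hp : 1 ≤ p) (hc : c = (p - 1 - a) / p) (hc01 : c ∈ Ioo (0 : ℝ) 1)
    (hline : ∀ z ∈ Icc (0 : ℝ) 1, (1 - z) ^ p - ((1 - c) / c) ^ p * z ^ p ≤
      -(p * (1 - c) ^ (p - 1) / c) * (z - c)) :
    IsLeast (admissibleConstants p a) (bestConstant p a) ∧
      bestConstant p a ^ p = ((1 - c) / c) ^ p := by
  have hac : a = p - 1 - p * c := by rw [hc]; field_simp; ring
  exact isLeast_of_line hp hac hc01.1 hc01.2
    (Real.rpow_nonneg (div_nonneg (sub_nonneg.2 hc01.2.le) hc01.1.le) _) hline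
    fun K hK => div_rpow_le_rpow_of_mem_admissibleConstants hp hac hc01.1 hc01.2 hK

theorem isLeast_alpha (hp1 : 1 < p) (hp2 : p < 2) (hc : c = (p - 1 - a) / p)
    (hc01 : c ∈ Ioo (0 : ℝ) 1) (hpc : p * c < 1) (hpc' : 1 < p * c ^ (p - 1)) :
    IsLeast (admissibleConstants p a) (bestConstant p a) ∧
      ∃ y, IsAlphaRoot p a y ∧ (∀ z, IsAlphaRoot p a z → z = y) ∧
        bestConstant p a ^ p = kFun p a y 1 := by
  have hac : a = p - 1 - p * c := by rw [hc]; field_simp; ring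
  have hiff : ∀ z, IsAlphaRoot p a z ↔ z ∈ Ioo 0 c ∧
      -(p - 1) * (1 - z) + p * (1 - c) - p * (1 - c) * z ^ (p - 1) = 0 := by
    intro z
    rw [IsAlphaRoot, ← hc, show p * (1 - c) = 1 + a by rw [hac]; ring, ← add_assoc]
  obtain ⟨y, hy, hroot, huniq⟩ := existsUnique_alpha_root hp1 hp2 hc01 hpc hpc'
  have hy1 : y ≤ 1 := by linarith [hy.2, hc01.2]
  have hk : kFun p a y 1 = (1 - c) * (1 - y) ^ p / ((1 - c) * y ^ p + (c - y)) := by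
    rw [kFun_eq hc hy.1.le hy1 zero_le_one le_rfl, sub_self, Real.zero_rpow (by linarith),
      Real.one_rpow, mul_zero, add_zero, mul_one]
  have hk0 : 0 ≤ kFun p a y 1 := by
    rw [hk]
    have h1c : 0 < 1 - c := sub_pos.2 hc01.2
    have hcy : 0 < c - y := sub_pos.2 hy.2
    have h1y : 0 ≤ 1 - y := sub_nonneg.2 hy1
    have hy0 := hy.1
    positivity
  have := isLeast_of_line hp1.le hac hc01.1 hc01.2 hk0
    (fun z hz => alpha_tangent_bound hp1 hp2 hy hc01.2 hroot hk hz) fun K hK =>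
      kFun_le_rpow_of_mem_admissibleConstants hp1.le hy.1.le (hc ▸ hy.2) (hc ▸ hc01.2) le_rfl hK
  exact ⟨this.1, y, (hiff y).2 ⟨hy, hroot⟩,
    fun z hz => huniq z ((hiff z).1 hz).1 ((hiff z).1 hz).2, this.2⟩

theorem isLeast_beta (hp2 : 2 < p) (hc : c = (p - 1 - a) / p)
    (hc01 : c ∈ Ioo (0 : ℝ) 1) (hpc : p * c < p - 1) (hpc' : p * (1 - c) ^ (p - 1) < 1) :
    IsLeast (admissibleConstants p a) (bestConstant p a) ∧
      ∃ y, IsBetaRoot p a y ∧ (∀ z, IsBetaRoot p a z → z = y) ∧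
        bestConstant p a ^ p = kFun p a 0 y := by
  have hp1 : 1 < p := by linarith
  have hac : a = p - 1 - p * c := by rw [hc]; field_simp; ring
  have hiff : ∀ z, IsBetaRoot p a z ↔ z ∈ Ioo c 1 ∧
      -(p * c) * (1 - z) ^ (p - 1) - (p - 1) * z + p * c = 0 := by
    intro z
    rw [IsBetaRoot, ← hc, show p * c = p - 1 - a by rw [hac]; ring, add_sub_assoc', ← add_sub_assoc]
  obtain ⟨y, hy, hroot, huniq⟩ := existsUnique_beta_root hp2 hc01 hpc hpc'
  have hy0 : 0 < y := hc01.1.trans hy.1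
  have hk : kFun p a 0 y = ((y - c) + c * (1 - y) ^ p) / (c * y ^ p) := by
    rw [kFun_eq hc le_rfl zero_le_one hy0.le hy.2.le, Real.zero_rpow (by linarith), sub_zero,
      sub_zero, Real.one_rpow, mul_one, mul_zero, zero_add]
  have hk0 : 0 ≤ kFun p a 0 y := by
    rw [hk]
    have h1c : 0 < y - c := sub_pos.2 hy.1
    have h1y : 0 < 1 - y := sub_pos.2 hy.2
    have hc0 := hc01.1
    positivity
  have := isLeast_of_line hp1.le hac hc01.1 hc01.2 hk0
    (fun z hz => beta_tangent_bound hp2 hy hc01.1 hroot hk hz) fun K hK =>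
      kFun_le_rpow_of_mem_admissibleConstants hp1.le le_rfl (hc ▸ hc01.1) (hc ▸ hy.1) hy.2.le hK
  exact ⟨this.1, y, (hiff y).2 ⟨hy, hroot⟩,
    fun z hz => huniq z ((hiff z).1 hz).1 ((hiff z).1 hz).2, this.2⟩

end Cases

end HardyDecreasing

theorem theorem2 (p a : ℝ) (hp : 1 ≤ p) (ha : -1 < a) (hap : a < p - 1) :
    -- the smallest admissible constant exists, and it is `A_{p,a}`
    IsLeast (HardyDecreasing.admissibleConstants p a) (HardyDecreasing.bestConstant p a) ∧
    (p = 1 → HardyDecreasing.bestConstant p a ^ p = (1 + a) / (-a)) ∧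
    (1 < p → p ≤ 2 → p - 1 - p ^ ((p - 2) / (p - 1)) ≤ a →
      HardyDecreasing.bestConstant p a ^ p = ((1 + a) / (p - 1 - a)) ^ p) ∧
    (1 < p → p ≤ 2 → p - 2 < a → a < p - 1 - p ^ ((p - 2) / (p - 1)) →
      ∃ α₀ : ℝ, HardyDecreasing.IsAlphaRoot p a α₀ ∧
        (∀ α : ℝ, HardyDecreasing.IsAlphaRoot p a α → α = α₀) ∧
        HardyDecreasing.bestConstant p a ^ p = HardyDecreasing.kFun p a α₀ 1) ∧
    (1 < p → p ≤ 2 → a ≤ p - 2 →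
      HardyDecreasing.bestConstant p a ^ p = (1 + a) / (p - 1 - a)) ∧
    (2 < p → p ^ ((p - 2) / (p - 1)) - 1 ≤ a →
      HardyDecreasing.bestConstant p a ^ p = ((1 + a) / (p - 1 - a)) ^ p) ∧
    (2 < p → 0 < a → a < p ^ ((p - 2) / (p - 1)) - 1 →
      ∃ β₀ : ℝ, HardyDecreasing.IsBetaRoot p a β₀ ∧
        (∀ β : ℝ, HardyDecreasing.IsBetaRoot p a β → β = β₀) ∧
        HardyDecreasing.bestConstant p a ^ p = HardyDecreasing.kFun p a 0 β₀) ∧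
    (2 < p → a ≤ 0 →
      HardyDecreasing.bestConstant p a ^ p = (1 + a) / (p - 1 - a)) := by
  obtain ⟨c, hc⟩ : ∃ c, c = (p - 1 - a) / p := ⟨_, rfl⟩
  have hp0 : 0 < p := by linarith
  have hpc : p * c = p - 1 - a := by rw [hc]; field_simp
  have hc0 : 0 < c := by rw [hc]; exact div_pos (by linarith) hp0
  have hc1 : c < 1 := by rw [hc, div_lt_one hp0]; linarith
  have hc01 : c ∈ Ioo (0 : ℝ) 1 := ⟨hc0, hc1⟩
  have h1c : 0 < 1 - c := sub_pos.2 hc1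
  have hp1c : p * (1 - c) = 1 + a := by linarith
  have hratio : (1 - c) / c = (1 + a) / (p - 1 - a) := by
    rw [← hpc, ← hp1c, mul_div_mul_left _ _ hp0.ne']
  have case_one : p = 1 → IsLeast (HardyDecreasing.admissibleConstants p a)
      (HardyDecreasing.bestConstant p a) ∧ HardyDecreasing.bestConstant p a ^ p = (1 - c) / c := by
    intro h
    refine HardyDecreasing.isLeast_chord hp hc hc01 fun z _ => le_of_eq ?_
    rw [h, Real.rpow_one, Real.rpow_one]
    field_simp
    ring
  have case_tangent_le_two : 1 < p → p ≤ 2 → p - 1 - p ^ ((p - 2) / (p - 1)) ≤ a →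
      IsLeast (HardyDecreasing.admissibleConstants p a) (HardyDecreasing.bestConstant p a) ∧
        HardyDecreasing.bestConstant p a ^ p = ((1 - c) / c) ^ p := fun h1 h2 h3 =>
    HardyDecreasing.isLeast_tangent hp hc hc01 fun z hz =>
      HardyDecreasing.tangent_bound_of_le_two h1 h2 hc01
        ((HardyDecreasing.mul_le_threshold_iff h1 hc0).1 (by linarith)) hz
  have case_alpha : 1 < p → p ≤ 2 → p - 2 < a → a < p - 1 - p ^ ((p - 2) / (p - 1)) →
      IsLeast (HardyDecreasing.admissibleConstants p a) (HardyDecreasing.bestConstant p a) ∧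
        ∃ y, HardyDecreasing.IsAlphaRoot p a y ∧
          (∀ z, HardyDecreasing.IsAlphaRoot p a z → z = y) ∧
          HardyDecreasing.bestConstant p a ^ p = HardyDecreasing.kFun p a y 1 := by
    intro h1 h2 h3 h4
    -- For p = 2 the threshold power is 1, and the hypotheses become 0 < a < 0.
    have h2' : p < 2 := by
      refine h2.lt_of_ne fun h => ?_
      rw [h] at h3 h4
      norm_num at h3 h4
      linarith
    exact HardyDecreasing.isLeast_alpha h1 h2' hc hc01 (by linarith)
      (not_le.1 fun h => absurd ((HardyDecreasing.mul_le_threshold_iff h1 hc0).2 h) (by linarith))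
  have case_chord_le_two : 1 < p → p ≤ 2 → a ≤ p - 2 →
      IsLeast (HardyDecreasing.admissibleConstants p a) (HardyDecreasing.bestConstant p a) ∧
        HardyDecreasing.bestConstant p a ^ p = (1 - c) / c := fun h1 h2 h3 =>
    HardyDecreasing.isLeast_chord hp hc hc01 fun z hz =>
      HardyDecreasing.chord_bound_of_le_two h1 h2 hc0 hc1 (by linarith) hz
  have case_tangent_two_lt : 2 < p → p ^ ((p - 2) / (p - 1)) - 1 ≤ a →
      IsLeast (HardyDecreasing.admissibleConstants p a) (HardyDecreasing.bestConstant p a) ∧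
        HardyDecreasing.bestConstant p a ^ p = ((1 - c) / c) ^ p := by
    intro h1 h2
    have h3 : 1 ≤ p * (1 - c) ^ (p - 1) := not_lt.1 fun h =>
      absurd ((HardyDecreasing.mul_lt_threshold_iff (by linarith) h1c).2 h) (by linarith)
    exact HardyDecreasing.isLeast_tangent hp hc hc01 fun z hz =>
      HardyDecreasing.tangent_bound_of_two_lt h1 hc01 h3 hz
  have case_beta : 2 < p → 0 < a → a < p ^ ((p - 2) / (p - 1)) - 1 →
      IsLeast (HardyDecreasing.admissibleConstants p a) (HardyDecreasing.bestConstant p a) ∧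
        ∃ y, HardyDecreasing.IsBetaRoot p a y ∧
          (∀ z, HardyDecreasing.IsBetaRoot p a z → z = y) ∧
          HardyDecreasing.bestConstant p a ^ p = HardyDecreasing.kFun p a 0 y :=
    fun h1 h2 h3 => HardyDecreasing.isLeast_beta h1 hc hc01 (by linarith)
      ((HardyDecreasing.mul_lt_threshold_iff (by linarith) h1c).1 (by linarith))
  have case_chord_two_lt : 2 < p → a ≤ 0 →
      IsLeast (HardyDecreasing.admissibleConstants p a) (HardyDecreasing.bestConstant p a) ∧
        HardyDecreasing.bestConstant p a ^ p = (1 - c) / c := fun h1 h2 =>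
    HardyDecreasing.isLeast_chord hp hc hc01 fun z hz =>
      HardyDecreasing.chord_bound_of_two_lt h1 hc0 hc1 (by linarith) hz
  rw [hratio] at case_one case_tangent_le_two case_chord_le_two
  rw [hratio] at case_tangent_two_lt case_chord_two_lt
  refine ⟨?_, fun h => ?_, fun h1 h2 h3 => (case_tangent_le_two h1 h2 h3).2,
    fun h1 h2 h3 h4 => (case_alpha h1 h2 h3 h4).2, fun h1 h2 h3 => (case_chord_le_two h1 h2 h3).2,
    fun h1 h2 => (case_tangent_two_lt h1 h2).2, fun h1 h2 h3 => (case_beta h1 h2 h3).2,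
    fun h1 h2 => (case_chord_two_lt h1 h2).2⟩
  · rcases hp.eq_or_lt with h1 | h1
    · exact (case_one h1.symm).1
    rcases le_or_gt p 2 with h2 | h2
    · rcases le_or_gt (p - 1 - p ^ ((p - 2) / (p - 1))) a with h3 | h3
      · exact (case_tangent_le_two h1 h2 h3).1
      rcases le_or_gt a (p - 2) with h4 | h4
      · exact (case_chord_le_two h1 h2 h4).1
      · exact (case_alpha h1 h2 h4 h3).1
    · rcases le_or_gt (p ^ ((p - 2) / (p - 1)) - 1) a with h3 | h3
      · exact (case_tangent_two_lt h2 h3).1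
      rcases le_or_gt a 0 with h4 | h4
      · exact (case_chord_two_lt h2 h4).1
      · exact (case_beta h2 h4 h3).1
  · rw [(case_one h).2, h, sub_self, zero_sub]
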